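/- **Setting.** A local dynamical system in primary normal form is $$\dot x^i=V^i(x)+\lambda^\alpha Z^i_\alpha(x),\qquad T_a(x)=0,\qquad \alpha=1,\dots,l,\quad a=1,\dots,m,$$ with $V,Z_\alpha,T_a$ real analytic on an open set $U\subset\mathbb R^n$ and undetermined multipliers $\lambda^\alpha(t)$. Let $U'\subset U$ be the set where $J=(\partial_iT_a)$ has its maximal rank, and $\Sigma=\{x\in U': T_a(x)=0\}$; the constraints are regular if $\Sigma\ne\emptyset$. Functions and vector fields vanishing on $\Sigma$ are called trivial. *Stabilization algorithm.* Let $s$ be the maximal rank of $M=(Z_\alpha T_a)$ on $\Sigma$ and $D=(Z_AT_B)$ an $s\times s$ minor of $M$ that is nondegenerate somewhere on $\Sigma$. One stage replaces $U$ by $\{x\in U':\det D\neq0\}$, $V$ by $V'=V-(VT_B)(D^{-1})^{BA}Z_A$, the fields by $Z'_{\alpha_1}=Z_{\alpha_1}-(Z_{\alpha_1}T_B)(D^{-1})^{BA}Z_A$ for the remaining indices $\alpha_1$, and the constraints by any regular analytic constraints having the zero locus $\{T_a=0,\ V'T_a=0\}$. The system is *regular* if the algorithm can be pursued indefinitely,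 never meeting inconsistent or irregular constraints, with connected surfaces $\Sigma$ at all stages. A *complete normal form* $(\bar U,\bar V,Z_{\alpha},T_{\bar a})$ of the system is an outcome of finitely many stages for which $\bar V$ and all $Z_\alpha$ are tangent to the corresponding surface $\bar\Sigma\neq\emptyset$ (the regular part of its constraint surface), with $\bar\Sigma$ connected. *Gauge distribution.* Let $\mathcal F$ be the field of fractions of the ring of analytic functions on $\bar U$ modulo those vanishing on $\bar\Sigma$. Distributions are $\mathcal F$-linear subspaces of $\mathrm{span}_{\mathcal F}(\partial/\partial x^1,\dots,\partial/\partial x^n)$, i.e. are taken modulo trivial vector fields. The gauge distribution $\mathcal Z_{V}$ of a complete normal form is the union over $k$ of the smallest involutive distributions containing all $[\bar V,[\dots,[\bar V,Z_\alpha]]]$ with at most $k$ commutators. Two systems are *physically equivalent* if they have complete normal forms with the same phase space $\bar U$, constraint surface $\bar\Sigma$, drift $\bar V$ and gauge distribution. *Observables* of a complete normal form are the classes, modulo trivial functions, of analytic functions $O$ on $\bar U$ with $ZO|_{\bar\Sigma}=0$ for all $Z\in\mathcal Z_V$. A *gauge symmetry* is an infinitesimal transformation $\delta_\varepsilon x=\sum_{j\le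 p}R_j\,\varepsilon^{(j)}$, $\delta_\varepsilon\lambda=\sum_{j\le p+1}Q_j\,\varepsilon^{(j)}$ (with finitely many arbitrary functions $\varepsilon(t)$, and $R_j,Q_j$ analytic in finitely many of the variables $x,\lambda,\dot\lambda,\dots$ on an open set) under which the equations of motion are invariant on every solution. Solutions lie in the regular part of the constraint surface. **Theorem (involutive normal form).** Every regular local dynamical system in primary normal form has a complete normal form. For each of its complete normal forms $(\bar U,\bar V,Z_\alpha,T_{\bar a})$: 1. $\mathcal Z_V$ is involutive, tangent to $\bar\Sigma$ and preserved by $\bar V$, i.e. $[\bar V,\mathcal Z_V]\subset\mathcal Z_V$. 2. There are vector fields $Z_{\bar\alpha}$, analytic on $\bar U$, whose classes form a basis of $\mathcal Z_V$. The system $$\dot x=\bar V+\lambda^{\bar\alpha}Z_{\bar\alpha},\qquad T_{\bar a}=0\qquad\text{(the involutive normal form)}$$ is regular, is its own complete normal form (no further compatibility conditions arise), its gauge distribution equals its characteristic distribution $\mathrm{span}\{Z_{\bar\alpha}\}=\mathcal Z_V$, and it is physically equivalent to the original system. 3. The involutive system and the given complete normal form have the same observables. If $O$ is (a representative of) an observable,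 so is $\bar VO$, and $\dot O=\bar VO$ holds along every solution of the original system that stays in the regular part of $\bar U$ and along every solution of the involutive system. 4. There are analytic functions $b,v,u$ on $\bar U$ such that $\{b\ne0\}$ is dense in $\bar\Sigma$ and, with $V_\alpha^\beta=v_\alpha^\beta/b$, $U_{\alpha\beta}^\gamma=u_{\alpha\beta}^\gamma/b$, the $Z_{\bar\alpha}$ are pointwise linearly independent and satisfy $[Z_{\bar\alpha},\bar V]=V_\alpha^\beta Z_{\bar\beta}$, $[Z_{\bar\alpha},Z_{\bar\beta}]=U_{\alpha\beta}^\gamma Z_{\bar\gamma}$ on $\bar\Sigma\cap\{b\neq0\}$ (and $b[Z_{\bar\alpha},\bar V]=v_\alpha^\beta Z_{\bar\beta}$, $b[Z_{\bar\alpha},Z_{\bar\beta}]=u_{\alpha\beta}^\gamma Z_{\bar\gamma}$ on all of $\bar\Sigma$). On $\{b\neq0\}$, $$\delta_\varepsilon x=Z_{\bar\alpha}\varepsilon^{\alpha},\qquad \delta_\varepsilon\lambda^{\alpha}=\dot\varepsilon^{\alpha}-\bigl(V^\alpha_\beta+U^\alpha_{\beta\gamma}\lambda^\gamma\bigr)\varepsilon^\beta$$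 is a gauge symmetry of the involutive system, and on its solutions with $b\ne0$ every gauge symmetry is of this form, with $\varepsilon^\alpha$ replaced by linear combinations of the parameters and their derivatives whose coefficients are analytic in $x,\lambda,\dot\lambda,\dots$. -/

import Mathlib

open scoped ContDiff

noncomputable section

/-- The linear space `ℝⁿ` with its coordinates `xⁱ`. -/
abbrev PhaseSpace (n : ℕ) : Type := Fin n → ℝ

/-- The derivative `X f = Xⁱ ∂ᵢ f` of a function along a vector field. -/
def alongField {n : ℕ} (X : PhaseSpace n → PhaseSpace n) (f : PhaseSpace n → ℝ) :
    PhaseSpace n → ℝ :=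
  fun x => fderiv ℝ f x (X x)

/-- A local dynamical system in primary normal form
`ẋ = V(x) + λ^α Z_α(x)`, `T_a(x) = 0`, with `V`, `Z_α`, `T_a` analytic on the open set `U`.
Values outside `U` carry no meaning. -/
structure LocalSystem (n : ℕ) where
  U : Set (PhaseSpace n)
  isOpen_U : IsOpen U
  /-- number of undetermined multipliers -/
  l : ℕ
  /-- number of constraints -/
  m : ℕ
  V : PhaseSpace n → PhaseSpace n
  Z : Fin l → PhaseSpace n → PhaseSpace n
  T : Fin m → PhaseSpace n → ℝ
  analytic_V : AnalyticOnNhd ℝ V U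
  analytic_Z : ∀ α, AnalyticOnNhd ℝ (Z α) U
  analytic_T : ∀ a, AnalyticOnNhd ℝ (T a) U

namespace LocalSystem

variable {n : ℕ}

/-- The Jacobi matrix `J = (∂ᵢ T_a)`. -/
def jacobi (S : LocalSystem n) (x : PhaseSpace n) : Matrix (Fin S.m) (Fin n) ℝ :=
  Matrix.of fun a i => fderiv ℝ (S.T a) x (Pi.single i 1)

/-- The regular part `U'` of `U` regarding the Jacobi matrix: the points of maximal rank. -/
def regularDomain (S : LocalSystem n) : Set (PhaseSpace n) :=
  {x | x ∈ S.U ∧ ∀ y ∈ S.U, (S.jacobi y).rank ≤ (S.jacobi x).rank}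

/-- The regular part `Σ' = U' ∩ Σ` of the constraint surface.
The constraints are regular when it is nonempty. -/
def surface (S : LocalSystem n) : Set (PhaseSpace n) :=
  {x | x ∈ S.regularDomain ∧ ∀ a, S.T a x = 0}

/-- The matrix `M = (Z_α T_a)`. -/
def conservationMatrix (S : LocalSystem n) (x : PhaseSpace n) :
    Matrix (Fin S.l) (Fin S.m) ℝ :=
  Matrix.of fun α a => alongField (S.Z α) (S.T a) x

/-- One stage of the stabilization algorithm, leading from `S` to `S'`.
The multipliers are split as `α = (A, α₁)` by `e`, the constraints `T_A` are selected by `g`,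
and `D = (Z_A T_B)` is a minor of `M` that is nondegenerate somewhere on the surface and whose
size is the maximal rank of `M` on the surface.  On `{x ∈ U' | det D(x) ≠ 0}` the multipliers
`λ^A` are eliminated, which gives the new drift and characteristic fields, and the constraints
of the new stage are any regular constraints whose zero locus is given by the old
constraints together with the secondary ones `V' T_a = 0` (identically satisfied for `a = A`). -/
def IsStage (S S' : LocalSystem n) : Prop :=
  ∃ (s : ℕ) (e : Fin s ⊕ Fin S'.l ≃ Fin S.l) (g : Fin s ↪ Fin S.m)
    (D : PhaseSpace n → Matrix (Fin s) (Fin s) ℝ),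
    (∀ x, D x = (S.conservationMatrix x).submatrix (fun A => e (Sum.inl A)) g) ∧
    (∀ x ∈ S.surface, (S.conservationMatrix x).rank ≤ s) ∧
    (∃ x ∈ S.surface, (D x).det ≠ 0) ∧
    S'.U = {x | x ∈ S.regularDomain ∧ (D x).det ≠ 0} ∧
    (∀ x ∈ S'.U, S'.V x = S.V x -
      ∑ A, ∑ B, (alongField S.V (S.T (g B)) x * (D x)⁻¹ B A) • S.Z (e (Sum.inl A)) x) ∧
    (∀ α, ∀ x ∈ S'.U, S'.Z α x = S.Z (e (Sum.inr α)) x -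
      ∑ A, ∑ B, (alongField (S.Z (e (Sum.inr α))) (S.T (g B)) x * (D x)⁻¹ B A) •
        S.Z (e (Sum.inl A)) x) ∧
    (∀ x ∈ S'.U, (∀ a, S'.T a x = 0) ↔ ∀ a, S.T a x = 0 ∧ alongField S'.V (S.T a) x = 0) ∧
    S'.surface.Nonempty

/-- `S'` is obtained from `S` by finitely many stages of the algorithm. -/
def Reaches (S S' : LocalSystem n) : Prop := Relation.ReflTransGen IsStage S S'

/-- No further compatibility conditions: drift and characteristic fields are tangent to the
(nonempty) constraint surface. -/
def IsComplete (S : LocalSystem n) : Prop :=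
  S.surface.Nonempty ∧
  (∀ a, ∀ x ∈ S.surface, alongField S.V (S.T a) x = 0) ∧
  ∀ α a, ∀ x ∈ S.surface, alongField (S.Z α) (S.T a) x = 0

/-- Regular systems: the algorithm can be pursued from stage to stage without ever meeting
inconsistent or irregular constraints, and the constraint surfaces are connected.
(From a complete system the algorithm can always go on, without changing anything.) -/
def IsRegular (S : LocalSystem n) : Prop :=
  ∃ run : ℕ → LocalSystem n, run 0 = S ∧ (∀ k, IsStage (run k) (run (k + 1))) ∧
    ∀ k, IsConnected (run k).surface

/-- `C` is a complete normal form of `S`: an outcome of the algorithm. -/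
def IsCompleteFormOf (C S : LocalSystem n) : Prop :=
  S.Reaches C ∧ C.IsComplete ∧ IsConnected C.surface

end LocalSystem

section Distributions

variable {n : ℕ}

/-- The ring of functions that are analytic on `U`. -/
def analyticRing (U : Set (PhaseSpace n)) : Subring (PhaseSpace n → ℝ) where
  carrier := {f | AnalyticOnNhd ℝ f U}
  mul_mem' hf hg := AnalyticOnNhd.mul hf hg
  one_mem' := analyticOnNhd_const
  add_mem' hf hg := AnalyticOnNhd.add hf hg
  zero_mem' := analyticOnNhd_const
  neg_mem' hf := AnalyticOnNhd.neg hf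

/-- The ideal of trivial functions: those that vanish on the constraint surface `M`. -/
def trivialIdeal (U M : Set (PhaseSpace n)) : Ideal (analyticRing U) where
  carrier := {f | ∀ x ∈ M, (f : PhaseSpace n → ℝ) x = 0}
  add_mem' := by
    intro f g hf hg x hx
    simp [hf x hx, hg x hx]
  zero_mem' := by
    intro x _
    rfl
  smul_mem' := by
    intro c f hf x hx
    simp [hf x hx]

/-- Classes of analytic functions modulo trivial ones. -/
def OnShellRing (U M : Set (PhaseSpace n)) : Type := analyticRing U ⧸ trivialIdeal U M

instance (U M : Set (PhaseSpace n)) : CommRing (OnShellRing U M) :=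
  inferInstanceAs (CommRing (analyticRing U ⧸ trivialIdeal U M))

/-- The class of an analytic function modulo trivial ones. -/
def onShell (U M : Set (PhaseSpace n)) : analyticRing U →+* OnShellRing U M :=
  Ideal.Quotient.mk (trivialIdeal U M)

/-- The fractions `a / b` of analytic functions, `b` nontrivial, modulo trivial functions
(a field when `M` is a connected regular constraint surface). -/
abbrev OnShellField (U M : Set (PhaseSpace n)) : Type := FractionRing (OnShellRing U M)

/-- The class modulo trivial ones of a vector field analytic on `U`, as an element of the
`n`-dimensional vector space spanned by the `∂ / ∂xⁱ` over `OnShellField U M`. -/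
def fieldClass (U M : Set (PhaseSpace n)) (X : PhaseSpace n → PhaseSpace n)
    (hX : AnalyticOnNhd ℝ X U) : Fin n → OnShellField U M :=
  fun i => algebraMap (OnShellRing U M) (OnShellField U M)
    (onShell U M ⟨fun x => X x i, fun x hx =>
      ((ContinuousLinearMap.proj (R := ℝ) (φ := fun _ : Fin n => ℝ) i).analyticAt (X x)).comp
        (hX x hx)⟩)

/-- A distribution on the constraint surface: a linear subspace of the space of vector fields
over the field of fractions. -/
abbrev VFDistribution (U M : Set (PhaseSpace n)) : Type :=
  Submodule (OnShellField U M) (Fin n → OnShellField U M)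

/-- The vector field `X` is analytic on `U` and belongs, modulo trivial fields, to `P`.
Every element of `P` is a multiple of the class of such a field. -/
def MemDist {U M : Set (PhaseSpace n)} (P : VFDistribution U M)
    (X : PhaseSpace n → PhaseSpace n) : Prop :=
  ∃ hX : AnalyticOnNhd ℝ X U, fieldClass U M X hX ∈ P

/-- `X` preserves the ideal of trivial functions.  The commutator of such fields is well defined
modulo trivial fields. -/
def PreservesTrivial (U M : Set (PhaseSpace n)) (X : PhaseSpace n → PhaseSpace n) : Prop :=
  ∀ f : PhaseSpace n → ℝ, AnalyticOnNhd ℝ f U → (∀ x ∈ M, f x = 0) →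
    ∀ x ∈ M, alongField X f x = 0

/-- `P` is involutive (modulo trivial fields): closed under commutators of its fields. -/
def IsInvolutive {U M : Set (PhaseSpace n)} (P : VFDistribution U M) : Prop :=
  ∀ X Y : PhaseSpace n → PhaseSpace n, PreservesTrivial U M X → PreservesTrivial U M Y →
    MemDist P X → MemDist P Y → MemDist P (VectorField.lieBracket ℝ X Y)

/-- The Lie closure: the smallest involutive distribution containing the given fields. -/
def lieClosure (U M : Set (PhaseSpace n)) (G : Set (PhaseSpace n → PhaseSpace n)) :
    VFDistribution U M :=
  sInf {P | IsInvolutive P ∧ ∀ X ∈ G, MemDist P X}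

/-- The span of the fields `Z_α`. -/
def spanFields (U M : Set (PhaseSpace n)) {l : ℕ} (Z : Fin l → PhaseSpace n → PhaseSpace n) :
    VFDistribution U M :=
  Submodule.span (OnShellField U M)
    {w | ∃ (α : Fin l) (h : AnalyticOnNhd ℝ (Z α) U), w = fieldClass U M (Z α) h}

/-- The `k`-th member of the filtration: the Lie closure of the fields
`[V, …, [V, Z_α]]` with at most `k` commutators. -/
def gaugeFiltration (U M : Set (PhaseSpace n)) (V : PhaseSpace n → PhaseSpace n) {l : ℕ}
    (Z : Fin l → PhaseSpace n → PhaseSpace n) (k : ℕ) : VFDistribution U M :=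
  lieClosure U M {X | ∃ (j : ℕ) (α : Fin l), j ≤ k ∧
    X = (fun W => VectorField.lieBracket ℝ V W)^[j] (Z α)}

/-- The gauge distribution `𝒵_V`: the limit of the filtration. -/
def gaugeDistribution (U M : Set (PhaseSpace n)) (V : PhaseSpace n → PhaseSpace n) {l : ℕ}
    (Z : Fin l → PhaseSpace n → PhaseSpace n) : VFDistribution U M :=
  ⨆ k, gaugeFiltration U M V Z k

/-- The physical observables: classes of analytic phase-space functions `O`
with `Z O = 0` on the constraint surface for every `Z` in the gauge distribution `P`. -/
def observables {U M : Set (PhaseSpace n)} (P : VFDistribution U M) : Set (OnShellRing U M) :=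
  {o | ∃ O : analyticRing U, onShell U M O = o ∧
    ∀ X, MemDist P X → ∀ x ∈ M, alongField X O x = 0}

/-- `O` is analytic on `U` and represents a physical observable. -/
def RepresentsObservable {U M : Set (PhaseSpace n)} (P : VFDistribution U M)
    (O : PhaseSpace n → ℝ) : Prop :=
  ∃ hO : AnalyticOnNhd ℝ O U,
    onShell U M ⟨O, hO⟩ ∈ observables P

end Distributions

namespace LocalSystem

variable {n : ℕ}

/-- The gauge distribution of a system in complete normal form. -/
abbrev gauge (C : LocalSystem n) : VFDistribution C.U C.surface :=
  gaugeDistribution C.U C.surface C.V C.Z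

/-- Two systems are physically equivalent when they have complete normal forms with the same
phase space, constraint surface, drift and gauge distribution. -/
def PhysicallyEquivalent (S S' : LocalSystem n) : Prop :=
  ∃ C C' : LocalSystem n, C.IsCompleteFormOf S ∧ C'.IsCompleteFormOf S' ∧
    C.U = C'.U ∧ C.surface = C'.surface ∧ Set.EqOn C.V C'.V C.U ∧
    gaugeDistribution C.U C.surface C.V C.Z = gaugeDistribution C.U C.surface C'.V C'.Z

/-- The system `ẋ = V + λ^α Y_α`, `T_a = 0`: same phase space, drift and constraints as `C`, with
`Y` in place of the characteristic fields. -/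
abbrev withFields (C : LocalSystem n) {r : ℕ} (Y : Fin r → PhaseSpace n → PhaseSpace n)
    (hY : ∀ α, AnalyticOnNhd ℝ (Y α) C.U) : LocalSystem n :=
  { C with l := r, Z := Y, analytic_Z := hY }

/-- `(x(t), λ(t))` solves the system for `t ∈ I`. -/
def IsSolution (S : LocalSystem n) (I : Set ℝ) (x : ℝ → PhaseSpace n)
    (lam : ℝ → Fin S.l → ℝ) : Prop :=
  ∀ t ∈ I, x t ∈ S.surface ∧ HasDerivAt x (S.V (x t) + ∑ α, lam t α • S.Z α (x t)) t

/-- A variation `(δx, δλ)` of a solution `(x, λ)` leaves the equations of motion invariant: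
`δ(ẋ - V - λ^α Z_α) = 0` and `δT_a = 0` on this solution. -/
def IsInvariantVariation (S : LocalSystem n) (I : Set ℝ) (x : ℝ → PhaseSpace n)
    (lam : ℝ → Fin S.l → ℝ) (dx : ℝ → PhaseSpace n) (dlam : ℝ → Fin S.l → ℝ) : Prop :=
  ∀ t ∈ I,
    HasDerivAt dx (fderiv ℝ S.V (x t) (dx t) +
      ∑ α, lam t α • fderiv ℝ (S.Z α) (x t) (dx t) + ∑ α, dlam t α • S.Z α (x t)) t ∧
    ∀ a, fderiv ℝ (S.T a) (x t) (dx t) = 0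

end LocalSystem

/-- The variables `x, λ, λ̇, …, λ^(k)`. -/
abbrev JetSpace (n l k : ℕ) : Type := PhaseSpace n × (Fin (k + 1) → Fin l → ℝ)

/-- The point `(x, λ, λ̇, …, λ^(k))` at time `t`. -/
def jetAt {n l : ℕ} (k : ℕ) (x : ℝ → PhaseSpace n) (lam : ℝ → Fin l → ℝ) (t : ℝ) :
    JetSpace n l k :=
  (x t, fun j α => iteratedDeriv j (fun s => lam s α) t)

/-- The data of an infinitesimal transformation
`δx = ∑_{j ≤ p} R_j ε^(j)`, `δλ = ∑_{j ≤ p + 1} Q_j ε^(j)`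
with several parameters `ε^A(t)` and with structure functions of finitely many of the variables
`x, λ, λ̇, …`, defined on `domain`. -/
structure InfTransformation (n l : ℕ) where
  params : ℕ
  order : ℕ
  jetOrder : ℕ
  domain : Set (JetSpace n l jetOrder)
  R : ℕ → Fin params → JetSpace n l jetOrder → PhaseSpace n
  Q : ℕ → Fin params → JetSpace n l jetOrder → Fin l → ℝ

namespace InfTransformation

variable {n l : ℕ}

/-- `δ_ε x` along a trajectory. -/
def deltaX (G : InfTransformation n l) (x : ℝ → PhaseSpace n) (lam : ℝ → Fin l → ℝ)
    (ε : ℝ → Fin G.params → ℝ) (t : ℝ) : PhaseSpace n :=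
  ∑ j ∈ Finset.range (G.order + 1), ∑ A,
    iteratedDeriv j (fun s => ε s A) t • G.R j A (jetAt G.jetOrder x lam t)

/-- `δ_ε λ` along a trajectory. -/
def deltaLam (G : InfTransformation n l) (x : ℝ → PhaseSpace n) (lam : ℝ → Fin l → ℝ)
    (ε : ℝ → Fin G.params → ℝ) (t : ℝ) : Fin l → ℝ :=
  ∑ j ∈ Finset.range (G.order + 2), ∑ A,
    iteratedDeriv j (fun s => ε s A) t • G.Q j A (jetAt G.jetOrder x lam t)

/-- `G` is a gauge symmetry of `S`: the structure functions are analytic on the open set `domain`,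
and for arbitrary smooth parameters the equations of motion are invariant on-shell. -/
def IsGaugeSymmetry (S : LocalSystem n) (G : InfTransformation n S.l) : Prop :=
  IsOpen G.domain ∧ (∀ w ∈ G.domain, w.1 ∈ S.U) ∧
  (∀ j A, AnalyticOnNhd ℝ (G.R j A) G.domain) ∧
  (∀ j A, AnalyticOnNhd ℝ (G.Q j A) G.domain) ∧
  ∀ (I : Set ℝ) (x : ℝ → PhaseSpace n) (lam : ℝ → Fin S.l → ℝ) (ε : ℝ → Fin G.params → ℝ),
    IsOpen I → ContDiffOn ℝ ∞ x I → ContDiffOn ℝ ∞ lam I → ContDiffOn ℝ ∞ ε I →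
    S.IsSolution I x lam → (∀ t ∈ I, jetAt G.jetOrder x lam t ∈ G.domain) →
    S.IsInvariantVariation I x lam (G.deltaX x lam ε) (G.deltaLam x lam ε)

/-- The transformation
`δx = Z_α ε^α`, `δλ^α = ε̇^α - (V^α_β + U^α_{βγ} λ^γ) ε^β`
on the set `{x ∈ U | b(x) ≠ 0}`, for `V^α_β = v β α / b` and `U^α_{βγ} = u β γ α / b`. -/
def simpleForm (U : Set (PhaseSpace n)) (Z : Fin l → PhaseSpace n → PhaseSpace n)
    (b : PhaseSpace n → ℝ) (v : Fin l → Fin l → PhaseSpace n → ℝ)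
    (u : Fin l → Fin l → Fin l → PhaseSpace n → ℝ) : InfTransformation n l where
  params := l
  order := 0
  jetOrder := 0
  domain := {w | w.1 ∈ U ∧ b w.1 ≠ 0}
  R := fun _ β w => Z β w.1
  Q := fun j β w α =>
    if j = 0 then -(v β α w.1 / b w.1 + ∑ γ, u β γ α w.1 / b w.1 * w.2 0 γ)
    else if α = β then 1 else 0

/-- Every transformation in `G` is, on every solution of `S` with `b ≠ 0`, the transformation
`G₀` taken with parameters that are linear in the parameters of `G` and their derivatives, with
coefficients `H` analytic in the variables `x, λ, λ̇, …`. -/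
def ReducesTo (S : LocalSystem n) (b : PhaseSpace n → ℝ) (G G₀ : InfTransformation n S.l) :
    Prop :=
  ∃ H : ℕ → Fin G.params → JetSpace n S.l G.jetOrder → Fin G₀.params → ℝ,
    (∀ j A, AnalyticOnNhd ℝ (H j A) {w | w ∈ G.domain ∧ b w.1 ≠ 0}) ∧
    ∀ (I : Set ℝ) (x : ℝ → PhaseSpace n) (lam : ℝ → Fin S.l → ℝ)
      (ε : ℝ → Fin G.params → ℝ) (η : ℝ → Fin G₀.params → ℝ),
      IsOpen I → ContDiffOn ℝ ∞ x I → ContDiffOn ℝ ∞ lam I → ContDiffOn ℝ ∞ ε I →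
      S.IsSolution I x lam →
      (∀ t ∈ I, jetAt G.jetOrder x lam t ∈ G.domain ∧ b (x t) ≠ 0) →
      (∀ t ∈ I, η t = ∑ j ∈ Finset.range (G.order + 1), ∑ A,
        iteratedDeriv j (fun s => ε s A) t • H j A (jetAt G.jetOrder x lam t)) →
      ∀ t ∈ I, G.deltaX x lam ε t = G₀.deltaX x lam η t ∧
        G.deltaLam x lam ε t = G₀.deltaLam x lam η t

end InfTransformation

end

/-! A regular constraint surface is locally the graph of an analytic map over its tangent space
(`exists_chart_of_maximal_rank`). Two facts follow. A field that annihilates the constraints on the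
surface preserves the whole ideal of trivial functions, and an analytic function vanishing on an
open piece of a connected surface vanishes on all of it. By the second fact the on-shell functions
form a domain, so distributions are subspaces of a finite-dimensional vector space over a field.

A complete form exists because neither the number of multipliers nor the dimension of the surface
grows along a run, so some stage changes neither. There the matrix `(Z_α T_a)` vanishes on the
surface and the old and new surfaces agree locally; unique continuation gives completeness
(`IsStage.isComplete`).

The gauge distribution is controlled by minimality. The tangent fields form an involutive
distribution containing its generators, by the commutator formula. So do the gauge fields whose
commutator with the drift is again a gauge field, by the Leibniz and Jacobi identities
(`MemDist.lieBracket_drift`). Hence each contains the gauge distribution. Clearing denominators in a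
basis gives analytic characteristic fields; since the drift preserves their span, the gauge
distribution they generate is the old one, and regularity, physical equivalence and the statements
on observables follow.

For the symmetries, the commutators and a dual basis are written with one common denominator `b`.
The product rule and the commutation relations show that the simple form is a symmetry. Conversely,
comparing coefficients of `ε^(i+1)` in the invariance condition expresses `R_i` through `R_{i+1}`,
its time derivative and the characteristic fields. Descending induction from `R_{p+1} = 0` puts
every `R_i` in the span of these fields (`IsGaugeSymmetry.coeffX_eq_sum`), and their pointwise
independence then fixes `δλ`. -/

noncomputable section

/-! ### Zero sets of analytic maps of locally maximal rank. -/

section LevelSets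

open Filter Topology Module

variable {E F : Type*} [NormedAddCommGroup E] [NormedSpace ℝ E] [FiniteDimensional ℝ E]
  [NormedAddCommGroup F] [NormedSpace ℝ F] [FiniteDimensional ℝ F]

/-- The zero set of an analytic map whose derivative has locally maximal rank at `x₀` is, near `x₀`,
the graph of an analytic map over the kernel of the derivative, along any given projection. -/
theorem exists_chart_of_maximal_rank {f : E → F} {x₀ : E} {L : E →L[ℝ] F}
    (hf : AnalyticAt ℝ f x₀) (hL : HasFDerivAt f L x₀)
    (hf0 : f x₀ = 0)
    (hrank : ∀ᶠ x in 𝓝 x₀, finrank ℝ (fderiv ℝ f x).range ≤ finrank ℝ L.range)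
    (p : E →L[ℝ] L.ker) (hp : ∀ y : L.ker, p y = y) :
    ∃ φ : L.ker → E, AnalyticAt ℝ φ 0 ∧ φ 0 = x₀ ∧
      HasFDerivAt φ L.ker.subtypeL 0 ∧
      (∀ᶠ y in 𝓝 0, f (φ y) = 0 ∧ p (φ y - x₀) = y) ∧
      ∀ᶠ x in 𝓝 x₀, f x = 0 → φ (p (x - x₀)) = x := by
  -- The implicit function theorem needs a surjective derivative, so it is applied to `q ∘ f`, with
  -- `q` a projection onto the range of `L`; the equation `f = 0` is recovered afterwards from the
  -- rank condition.
  let R := L.range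
  obtain ⟨q, hq⟩ : ∃ q : F →L[ℝ] R, ∀ y : R, q y = y := by
    obtain ⟨q, hq⟩ := LinearMap.exists_leftInverse_of_injective R.subtype (by simp)
    exact ⟨LinearMap.toContinuousLinearMap q, fun y => by
      simpa using LinearMap.congr_fun hq y⟩
  have hqL : ∀ x, ((q (L x) : R) : F) = L x := fun x => congrArg Subtype.val (hq ⟨L x, x, rfl⟩)
  have hker : (q.comp L).ker = L.ker := by
    ext x
    constructor
    · intro h
      have h' : q (L x) = 0 := h
      show L x = 0
      rw [← hqL, h']; rfl
    · intro h
      have h' : L x = 0 := h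
      show q (L x) = 0
      rw [h', map_zero]
  have hqs : HasStrictFDerivAt (fun x => q (f x)) (q.comp L) x₀ :=
    by
    have h := hf.hasStrictFDerivAt
    rw [hL.fderiv] at h
    exact q.hasStrictFDerivAt.comp x₀ h
  have hsurj : (q.comp L).range = ⊤ := by
    rw [eq_top_iff]
    rintro ⟨_, x, rfl⟩ -
    exact ⟨x, hq ⟨L x, x, rfl⟩⟩
  let D : ImplicitFunctionData ℝ E R L.ker :=
    { leftFun := fun x => q (f x)
      leftDeriv := q.comp L
      rightFun := fun x => p (x - x₀)
      rightDeriv := p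
      pt := x₀
      hasStrictFDerivAt_leftFun := hqs
      hasStrictFDerivAt_rightFun := p.hasStrictFDerivAt.comp x₀
        ((hasStrictFDerivAt_id x₀).sub_const x₀)
      range_leftDeriv := hsurj
      range_rightDeriv := LinearMap.range_eq_of_proj hp
      isCompl_ker := by rw [hker]; exact LinearMap.isCompl_of_proj hp }
  have hD0 : D.prodFun D.pt = (0, 0) := by
    show (q (f x₀), p (x₀ - x₀)) = (0, 0)
    simp [hf0]
  have hl0 : D.leftFun D.pt = 0 := congrArg Prod.fst hD0
  have hr0 : D.rightFun D.pt = 0 := congrArg Prod.snd hD0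
  let φ : L.ker → E := D.implicitFunction 0
  have hle : ∀ᶠ y : L.ker in 𝓝 0, D.prodFun (D.implicitFunction 0 y) = (0, y) := by
    have h := D.prodFun_implicitFunction
    rw [hD0] at h
    have hc : Tendsto (fun y : L.ker => ((0 : R), y)) (𝓝 0) (𝓝 (0, 0)) :=
      (Continuous.prodMk_right (0 : R)).tendsto 0
    exact hc.eventually h
  have hφ0 : φ 0 = x₀ := by
    have h := D.implicitFunction_apply_image.self_of_nhds
    rw [hl0, hr0] at h
    exact h
  have hφan : AnalyticAt ℝ φ 0 := by
    have hlω : ContDiffAt ℝ ω D.leftFun D.pt :=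
      (q.analyticAt _).comp hf |>.contDiffAt
    have hrω : ContDiffAt ℝ ω D.rightFun D.pt :=
      ((p.analyticAt _).comp (analyticAt_id.sub analyticAt_const)).contDiffAt
    have h := (ImplicitFunctionData.contDiffAt_implicitFunction hlω hrω (by simp)).analyticAt
    rw [hD0] at h
    exact h.comp_of_eq (f := fun y : L.ker => ((0 : R), y))
      (analyticAt_const.prod analyticAt_id) rfl
  have hφd : HasFDerivAt φ L.ker.subtypeL 0 := by
    have h := (D.hasStrictFDerivAt_implicitFunction L.ker.subtypeL
      (by ext1 y; exact hp y)
      (by ext1 y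
          show q (L y) = 0
          rw [show L y = 0 from y.2, map_zero])).hasFDerivAt
    rw [hl0, hr0] at h
    exact h
  -- Near `x₀` the map `q ∘ Df(x)` is still onto `R`, while the range of `Df(x)` has at most the
  -- dimension of `R`; hence `q` is injective on that range.
  have hinj : ∀ᶠ x in 𝓝 x₀, ∀ v, q (fderiv ℝ f x v) = 0 → fderiv ℝ f x v = 0 := by
    have hcont : Tendsto (fun x => q.comp (fderiv ℝ f x)) (𝓝 x₀) (𝓝 (q.comp L)) := by
      rw [← hL.fderiv]
      exact (((ContinuousLinearMap.compL ℝ E F R) q).continuous.tendsto _).comp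
        hf.fderiv.continuousAt
    -- Surjectivity is an open condition: composed with a fixed right inverse of `q ∘ L`, a nearby
    -- map is close to the identity and so invertible.
    have hop : ∀ᶠ A : E →L[ℝ] R in 𝓝 (q.comp L), Function.Surjective A := by
      obtain ⟨s, hs⟩ := LinearMap.exists_rightInverse_of_surjective (q.comp L).toLinearMap hsurj
      let s' : R →L[ℝ] E := LinearMap.toContinuousLinearMap s
      have hc : Tendsto (fun A : E →L[ℝ] R => A.comp s') (𝓝 (q.comp L))
          (𝓝 ((q.comp L).comp s')) :=
        (((ContinuousLinearMap.compL ℝ R E R).flip s').continuous.tendsto _)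
      have hu : IsUnit ((q.comp L).comp s') := by
        have : (q.comp L).comp s' = 1 := by
          ext1 y; exact LinearMap.congr_fun hs y
        rw [this]; exact isUnit_one
      have hN : {A : R →L[ℝ] R | IsUnit A} ∈ 𝓝 ((q.comp L).comp s') :=
        (Units.isOpen (R := R →L[ℝ] R)).mem_nhds hu
      have := hc.eventually_mem hN
      filter_upwards [this] with A hA y
      obtain ⟨u, hu⟩ := hA
      refine ⟨s' ((u⁻¹ : (R →L[ℝ] R)ˣ).val y), ?_⟩
      have h1 : u.val * (u⁻¹).val = 1 := u.mul_inv
      rw [hu] at h1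
      exact ContinuousLinearMap.ext_iff.1 h1 y
    filter_upwards [hcont.eventually hop, hrank] with x hx hr v hv
    let g : (fderiv ℝ f x).range →ₗ[ℝ] R := q.toLinearMap.comp (fderiv ℝ f x).range.subtype
    have hgs : Function.Surjective g := fun y => by
      obtain ⟨w, hw⟩ := hx y
      exact ⟨⟨fderiv ℝ f x w, w, rfl⟩, hw⟩
    have hfin : finrank ℝ (fderiv ℝ f x).range = finrank ℝ R :=
      le_antisymm hr (LinearMap.finrank_le_finrank_of_surjective hgs)
    have hgi : Function.Injective g :=
      (LinearMap.injective_iff_surjective_of_finrank_eq_finrank hfin).2 hgs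
    have := @hgi ⟨fderiv ℝ f x v, v, rfl⟩ 0 (by rw [map_zero]; exact hv)
    exact congrArg Subtype.val this
  -- Along `φ` the function `q ∘ f` is zero, so its derivative is too; by `hinj` the derivative of
  -- `f ∘ φ` vanishes on a ball and `f ∘ φ` keeps its value `f x₀ = 0`.
  have hzero : ∀ᶠ y in 𝓝 (0 : L.ker), f (φ y) = 0 := by
    have hφc : Tendsto φ (𝓝 0) (𝓝 x₀) := by
      have := hφan.continuousAt
      rwa [ContinuousAt, hφ0] at this
    have h1 := hφc.eventually hinj
    have h2 := hφc.eventually hf.eventually_analyticAt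
    have h3 := hφan.eventually_analyticAt
    have h4 := hle.eventually_nhds
    obtain ⟨ε, hε, hball⟩ := Metric.eventually_nhds_iff_ball.1 (h1.and (h2.and (h3.and h4)))
    refine Metric.eventually_nhds_iff_ball.2 ⟨ε, hε, fun y hy => ?_⟩
    have hdiff : ∀ z ∈ Metric.ball (0 : L.ker) ε,
        HasFDerivAt (fun y => f (φ y)) ((fderiv ℝ f (φ z)).comp (fderiv ℝ φ z)) z := by
      intro z hz
      obtain ⟨-, ha, hb, -⟩ := hball z hz
      exact ha.differentiableAt.hasFDerivAt.comp z hb.differentiableAt.hasFDerivAt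
    have hd0 : ∀ z ∈ Metric.ball (0 : L.ker) ε,
        (fderiv ℝ f (φ z)).comp (fderiv ℝ φ z) = 0 := by
      intro z hz
      obtain ⟨hi, -, -, he⟩ := hball z hz
      ext1 v
      apply hi
      have h5 : HasFDerivAt (fun y => q (f (φ y)))
          (q.comp ((fderiv ℝ f (φ z)).comp (fderiv ℝ φ z))) z :=
        q.hasFDerivAt.comp z (hdiff z hz)
      have h6 : (fun y => q (f (φ y))) =ᶠ[𝓝 z] fun _ => 0 := by
        filter_upwards [he] with y hy
        exact congrArg Prod.fst hy
      have h7 := h5.unique ((hasFDerivAt_const (0 : R) z).congr_of_eventuallyEq h6)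
      exact ContinuousLinearMap.ext_iff.1 h7 v
    have hconst := (convex_ball (0 : L.ker) ε).is_const_of_fderivWithin_eq_zero (𝕜 := ℝ)
      (f := fun y => f (φ y)) (fun z hz => (hdiff z hz).differentiableAt.differentiableWithinAt)
      (fun z hz => by
        rw [fderivWithin_of_isOpen Metric.isOpen_ball hz, (hdiff z hz).fderiv, hd0 z hz])
      hy (Metric.mem_ball_self hε)
    exact hconst.trans (by rw [hφ0, hf0])
  refine ⟨φ, hφan, hφ0, hφd, ?_, ?_⟩
  · filter_upwards [hzero, hle] with y h1 h2
    exact ⟨h1, congrArg Prod.snd h2⟩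
  · filter_upwards [D.implicitFunction_apply_image] with x hx hfx
    have : D.leftFun x = 0 := by show q (f x) = 0; rw [hfx, map_zero]
    rw [this] at hx
    exact hx

end LevelSets

/-! ### Regular constraint surfaces: charts, tangency, unique continuation, dimension. -/

namespace LocalSystem

open Filter Topology Module

variable {n : ℕ} (S : LocalSystem n)

/-- The differential of all constraints `T_a` at a point. -/
def constraintDeriv (x : PhaseSpace n) : PhaseSpace n →L[ℝ] (Fin S.m → ℝ) :=
  ContinuousLinearMap.pi fun a => fderiv ℝ (S.T a) x

theorem mem_ker_constraintDeriv {x v : PhaseSpace n} :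
    v ∈ (S.constraintDeriv x).ker ↔ ∀ a, fderiv ℝ (S.T a) x v = 0 := by
  constructor
  · intro h a
    exact congrFun (show S.constraintDeriv x v = 0 from h) a
  · intro h
    show S.constraintDeriv x v = 0
    exact funext h

theorem hasFDerivAt_constraints {x : PhaseSpace n} (hx : x ∈ S.U) :
    HasFDerivAt (fun x a => S.T a x) (S.constraintDeriv x) x :=
  hasFDerivAt_pi.2 fun a => (S.analytic_T a x hx).differentiableAt.hasFDerivAt

theorem rank_jacobi (x : PhaseSpace n) :
    (S.jacobi x).rank = finrank ℝ (S.constraintDeriv x).range := by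
  have h : (S.jacobi x).mulVecLin = (S.constraintDeriv x).toLinearMap := by
    refine LinearMap.pi_ext' fun i => LinearMap.ext_ring ?_
    funext a
    simp [jacobi, constraintDeriv, Matrix.mulVec_single]
  rw [Matrix.rank, h]

/-- The rank is lower semicontinuous, so near a point of maximal rank it cannot drop, and it cannot
rise either. -/
theorem isOpen_regularDomain : IsOpen S.regularDomain := by
  rw [isOpen_iff_mem_nhds]
  rintro x ⟨hx, hmax⟩
  have hcont : ContinuousAt S.constraintDeriv x := by
    have h : ContinuousAt (fderiv ℝ fun x a => S.T a x) x :=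
      (AnalyticAt.pi fun a => S.analytic_T a x hx).fderiv.continuousAt
    refine h.congr ?_
    filter_upwards [S.isOpen_U.mem_nhds hx] with y hy
    exact (S.hasFDerivAt_constraints hy).fderiv
  have hop := isOpen_setOfPred_nat_le_rank (𝕜 := ℝ) (E := PhaseSpace n)
    (F := Fin S.m → ℝ) (S.jacobi x).rank
  have hev := hcont.eventually_mem (hop.mem_nhds (by
    simp [rank_jacobi, LinearMap.rank]))
  filter_upwards [S.isOpen_U.mem_nhds hx, hev] with y hy hle
  refine ⟨hy, fun z hz => (hmax z hz).trans ?_⟩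
  rw [S.rank_jacobi y]
  simp only [LinearMap.rank] at hle
  rw [← finrank_eq_rank] at hle
  exact_mod_cast hle

theorem surface_subset_U : S.surface ⊆ S.U := fun _ hx => hx.1.1

/-- The regular constraint surface near one of its points. -/
theorem exists_chart {x₀ : PhaseSpace n} (hx₀ : x₀ ∈ S.surface)
    {K : Submodule ℝ (PhaseSpace n)} (hK : (S.constraintDeriv x₀).ker = K)
    (p : PhaseSpace n →L[ℝ] K) (hp : ∀ y : K, p y = y) :
    ∃ φ : K → PhaseSpace n, AnalyticAt ℝ φ 0 ∧ φ 0 = x₀ ∧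
      HasFDerivAt φ K.subtypeL 0 ∧
      (∀ᶠ y in 𝓝 0, φ y ∈ S.surface ∧ p (φ y - x₀) = y) ∧
      ∀ᶠ x in 𝓝 x₀, x ∈ S.surface → φ (p (x - x₀)) = x := by
  subst hK
  have hU := hx₀.1.1
  obtain ⟨φ, h1, h2, h3, h4, h5⟩ := exists_chart_of_maximal_rank
    (AnalyticAt.pi fun a => S.analytic_T a x₀ hU) (S.hasFDerivAt_constraints hU)
    (funext hx₀.2) (by
      filter_upwards [S.isOpen_U.mem_nhds hU] with x hx
      rw [(S.hasFDerivAt_constraints hx).fderiv, ← rank_jacobi, ← rank_jacobi]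
      exact hx₀.1.2 x hx) p hp
  refine ⟨φ, h1, h2, h3, ?_, ?_⟩
  · have hc : Tendsto φ (𝓝 0) (𝓝 x₀) := by
      have := h1.continuousAt
      rwa [ContinuousAt, h2] at this
    filter_upwards [h4, hc.eventually_mem (S.isOpen_regularDomain.mem_nhds hx₀.1)] with y hy hr
    exact ⟨⟨hr, congrFun hy.1⟩, hy.2⟩
  · filter_upwards [h5] with x hx hs
    exact hx (funext hs.2)

theorem _root_.Submodule.exists_continuous_projection (K : Submodule ℝ (PhaseSpace n)) :
    ∃ p : PhaseSpace n →L[ℝ] K, ∀ y : K, p y = y := by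
  obtain ⟨p, hp⟩ := LinearMap.exists_leftInverse_of_injective K.subtype (by simp)
  exact ⟨LinearMap.toContinuousLinearMap p, fun y => LinearMap.congr_fun hp y⟩

/-- The differential of a function vanishing on the surface annihilates tangent vectors. -/
theorem fderiv_eq_zero_of_tangent {f : PhaseSpace n → ℝ} {x₀ v : PhaseSpace n}
    (hx₀ : x₀ ∈ S.surface) (hf : DifferentiableAt ℝ f x₀) (hf0 : ∀ x ∈ S.surface, f x = 0)
    (hv : ∀ a, fderiv ℝ (S.T a) x₀ v = 0) : fderiv ℝ f x₀ v = 0 := by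
  obtain ⟨p, hp⟩ := (S.constraintDeriv x₀).ker.exists_continuous_projection
  obtain ⟨φ, -, h2, h3, h4, -⟩ := S.exists_chart hx₀ rfl p hp
  have h5 : HasFDerivAt (fun y => f (φ y))
      ((fderiv ℝ f x₀).comp (S.constraintDeriv x₀).ker.subtypeL) 0 := by
    have : HasFDerivAt f (fderiv ℝ f x₀) (φ 0) := by rw [h2]; exact hf.hasFDerivAt
    exact this.comp 0 h3
  have h6 : (fun y => f (φ y)) =ᶠ[𝓝 0] fun _ => 0 := by
    filter_upwards [h4] with y hy
    exact hf0 _ hy.1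
  have h7 := h5.unique ((hasFDerivAt_const (0 : ℝ) _).congr_of_eventuallyEq h6)
  exact ContinuousLinearMap.ext_iff.1 h7 ⟨v, S.mem_ker_constraintDeriv.2 hv⟩

/-- On a regular surface tangency need only be tested on the constraints: the tangent space is the
common kernel of their differentials, and a trivial function is constant along charts. -/
theorem preservesTrivial_of_tangent {X : PhaseSpace n → PhaseSpace n}
    (hX : ∀ a, ∀ x ∈ S.surface, alongField X (S.T a) x = 0) :
    PreservesTrivial S.U S.surface X := fun _ hf hf0 x hx =>
  S.fderiv_eq_zero_of_tangent hx (hf x (S.surface_subset_U hx)).differentiableAt hf0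
    fun a => hX a x hx

/-- Unique continuation on a connected regular constraint surface. -/
theorem eqOn_zero_of_eventually (hS : IsPreconnected S.surface) {f : PhaseSpace n → ℝ}
    (hf : AnalyticOnNhd ℝ f S.U) {x₀ : PhaseSpace n} (hx₀ : x₀ ∈ S.surface)
    (h0 : ∀ᶠ x in 𝓝 x₀, x ∈ S.surface → f x = 0) : ∀ x ∈ S.surface, f x = 0 := by
  suffices hloc : ∀ x ∈ S.surface, ∀ᶠ z in 𝓝 x, z ∈ S.surface →
      (∀ᶠ y in 𝓝 z, y ∈ S.surface → f y = 0) → ∀ᶠ y in 𝓝 x, y ∈ S.surface → f y = 0 by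
    -- By preconnectedness it suffices that "vanishing near the point, on the surface" is locally
    -- constant. The nontrivial half is `hloc`: if it holds at a surface point close enough to `x`,
    -- then it holds at `x`.
    refine fun x hx => ((hS.induction₂
      (fun x y => (∀ᶠ z in 𝓝 x, z ∈ S.surface → f z = 0) ↔
        ∀ᶠ z in 𝓝 y, z ∈ S.surface → f z = 0)
      (fun x hx => by
        refine eventually_nhdsWithin_iff.2 ?_
        by_cases h : ∀ᶠ z in 𝓝 x, z ∈ S.surface → f z = 0
        · filter_upwards [h.eventually_nhds] with z hz _
          exact ⟨fun _ => hz, fun _ => h⟩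
        · filter_upwards [hloc x hx] with z hz hzS
          exact ⟨fun h' => absurd h' h, hz hzS⟩)
      (fun x y z _ _ _ h1 h2 => h1.trans h2) (fun x y _ _ h => h.symm)
      hx₀ hx).1 h0).self_of_nhds hx
  intro x hx
  obtain ⟨p, hp⟩ := (S.constraintDeriv x).ker.exists_continuous_projection
  obtain ⟨φ, h1, h2, -, h4, h5⟩ := S.exists_chart hx rfl p hp
  obtain ⟨ε, hε, hball⟩ := Metric.eventually_nhds_iff_ball.1
    (h4.and h1.eventually_analyticAt)
  have han : AnalyticOnNhd ℝ (fun y => f (φ y)) (Metric.ball 0 ε) := fun y hy =>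
    (hf _ (S.surface_subset_U (hball y hy).1.1)).comp (hball y hy).2
  have hpc : Tendsto (fun z => p (z - x)) (𝓝 x) (𝓝 0) := by
    have : Continuous fun z => p (z - x) := by fun_prop
    simpa using this.tendsto x
  have hev := h5.and (hpc.eventually_mem (Metric.ball_mem_nhds _ hε))
  filter_upwards [hev] with z hz hzS hzero
  have hw := hz.1 hzS
  have hcw : Tendsto φ (𝓝 (p (z - x))) (𝓝 z) := by
    have := (hball _ hz.2).2.continuousAt
    rwa [ContinuousAt, hw] at this
  have hloc : (fun y => f (φ y)) =ᶠ[𝓝 (p (z - x))] 0 := by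
    filter_upwards [hcw.eventually hzero, Metric.isOpen_ball.mem_nhds hz.2] with y hy hy'
    exact hy (hball y hy').1.1
  -- In the chart the claim is the identity theorem for analytic functions on a ball.
  have hall := han.eqOn_zero_of_preconnected_of_eventuallyEq_zero
    (convex_ball _ _).isPreconnected hz.2 hloc
  filter_upwards [hev] with x' hx' hx'S
  rw [← hx'.1 hx'S]
  exact hall hx'.2

theorem finrank_ker_constraintDeriv (x : PhaseSpace n) :
    (S.jacobi x).rank + finrank ℝ (S.constraintDeriv x).ker = n := by
  rw [rank_jacobi]
  simpa using (S.constraintDeriv x).toLinearMap.finrank_range_add_finrank_ker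

variable {S} {S' : LocalSystem n}

/-- The constraints of `S` vanish on the smaller surface, so their differentials annihilate its
tangent vectors. -/
theorem ker_constraintDeriv_le (hsub : S'.surface ⊆ S.surface) {x : PhaseSpace n}
    (hx : x ∈ S'.surface) : (S'.constraintDeriv x).ker ≤ (S.constraintDeriv x).ker := by
  intro v hv
  rw [mem_ker_constraintDeriv] at hv ⊢
  exact fun a => S'.fderiv_eq_zero_of_tangent hx
    (S.analytic_T a x (S.surface_subset_U (hsub hx))).differentiableAt
    (fun y hy => (hsub hy).2 a) hv

theorem rank_jacobi_le_of_surface_subset (hsub : S'.surface ⊆ S.surface) {x : PhaseSpace n}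
    (hx : x ∈ S'.surface) : (S.jacobi x).rank ≤ (S'.jacobi x).rank := by
  have h1 := S.finrank_ker_constraintDeriv x
  have h2 := S'.finrank_ker_constraintDeriv x
  have h3 := Submodule.finrank_mono (ker_constraintDeriv_le hsub hx)
  omega

/-- A regular constraint surface contained in another one of the same dimension is open in it. -/
theorem eventually_mem_surface_of_rank_eq (hsub : S'.surface ⊆ S.surface) {x : PhaseSpace n}
    (hx : x ∈ S'.surface) (hrank : (S.jacobi x).rank = (S'.jacobi x).rank) :
    ∀ᶠ y in 𝓝 x, y ∈ S.surface → y ∈ S'.surface := by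
  have h1 := S.finrank_ker_constraintDeriv x
  have h2 := S'.finrank_ker_constraintDeriv x
  have hK : (S'.constraintDeriv x).ker = (S.constraintDeriv x).ker :=
    Submodule.eq_of_le_of_finrank_eq (ker_constraintDeriv_le hsub hx) (by omega)
  obtain ⟨p, hp⟩ := (S.constraintDeriv x).ker.exists_continuous_projection
  obtain ⟨φ, -, -, -, -, h5⟩ := S.exists_chart (hsub hx) rfl p hp
  obtain ⟨ψ, g1, g2, -, g4, -⟩ := S'.exists_chart hx hK p hp
  have hψc : Tendsto ψ (𝓝 0) (𝓝 x) := by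
    have := g1.continuousAt
    rwa [ContinuousAt, g2] at this
  have hpc : Tendsto (fun z => p (z - x)) (𝓝 x) (𝓝 0) := by
    have : Continuous fun z => p (z - x) := by fun_prop
    simpa using this.tendsto x
  -- With `w = p (y - x)`, the point `ψ w` lies on the smaller surface and has the same projection
  -- `w` as `y`. The chart `φ` of the larger surface recovers both from `w`, so `y = ψ w`.
  filter_upwards [h5, hpc.eventually g4, hpc.eventually (hψc.eventually h5)] with y hy hg hh hyS
  have e1 := hh (hsub hg.1)
  rw [hg.2, hy hyS] at e1
  rw [e1]
  exact hg.1

theorem rank_jacobi_eq {x y : PhaseSpace n} (hx : x ∈ S.surface) (hy : y ∈ S.surface) :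
    (S.jacobi x).rank = (S.jacobi y).rank :=
  le_antisymm (hy.1.2 x hx.1.1) (hx.1.2 y hy.1.1)

end LocalSystem

/-! ### The stabilization algorithm: termination and transport of solutions. -/

theorem AnalyticOnNhd.alongField {n : ℕ} {U : Set (PhaseSpace n)}
    {X : PhaseSpace n → PhaseSpace n} {f : PhaseSpace n → ℝ} (hX : AnalyticOnNhd ℝ X U)
    (hf : AnalyticOnNhd ℝ f U) : AnalyticOnNhd ℝ (alongField X f) U := fun x hx =>
  (ContinuousLinearMap.analyticAt_bilinear (ContinuousLinearMap.id ℝ (PhaseSpace n →L[ℝ] ℝ))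
    (fderiv ℝ f x, X x)).comp₂ (hf x hx).fderiv (hX x hx)

/-- If an invertible `s × s` minor has the size of the rank, all rows are combinations of the rows
of this minor. -/
theorem Matrix.row_eq_of_rank_le {l m s : ℕ} (M : Matrix (Fin l) (Fin m) ℝ) (r : Fin s → Fin l)
    (g : Fin s → Fin m) (hdet : (M.submatrix r g).det ≠ 0) (hrank : M.rank ≤ s)
    (i : Fin l) (a : Fin m) :
    M i a = ∑ A, ∑ B, M i (g B) * (M.submatrix r g)⁻¹ B A * M (r A) a := by
  set D := M.submatrix r g with hD
  have hunit : IsUnit D.det := isUnit_iff_ne_zero.2 hdet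
  have hli : LinearIndependent ℝ fun A => M (r A) := by
    have h1 : LinearIndependent ℝ D.row :=
      Matrix.linearIndependent_rows_iff_isUnit.2 ((Matrix.isUnit_iff_isUnit_det D).2 hunit)
    exact LinearIndependent.of_comp (LinearMap.funLeft ℝ ℝ g) h1
  have hspan : Submodule.span ℝ (Set.range fun A => M (r A)) =
      Submodule.span ℝ (Set.range M.row) := by
    refine Submodule.eq_of_le_of_finrank_le (Submodule.span_mono ?_) ?_
    · rintro _ ⟨A, rfl⟩
      exact ⟨r A, rfl⟩
    · rw [← Matrix.rank_eq_finrank_span_row, finrank_span_eq_card hli]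
      simpa using hrank
  have hmem : M i ∈ Submodule.span ℝ (Set.range fun A => M (r A)) := by
    rw [hspan]
    exact Submodule.subset_span ⟨i, rfl⟩
  obtain ⟨d, hd⟩ := (Submodule.mem_span_range_iff_exists_fun ℝ).1 hmem
  -- The coefficients of the expansion are determined by the selected columns alone, where the minor
  -- can be inverted.
  have hdD : Matrix.vecMul d D = fun B => M i (g B) := by
    funext B
    rw [← hd]
    simp [Matrix.vecMul, dotProduct, hD]
  have hd' : d = Matrix.vecMul (fun B => M i (g B)) D⁻¹ := by
    rw [← hdD, Matrix.vecMul_vecMul, Matrix.mul_nonsing_inv _ hunit, Matrix.vecMul_one]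
  calc M i a = ∑ A, d A * M (r A) a := by rw [← hd]; simp
    _ = _ := by
      refine Finset.sum_congr rfl fun A _ => ?_
      rw [hd', Matrix.vecMul, dotProduct, Finset.sum_mul]

namespace LocalSystem

open Filter Topology Module

variable {n : ℕ} {S S' : LocalSystem n}

theorem IsStage.U_subset (h : IsStage S S') : S'.U ⊆ S.regularDomain := by
  obtain ⟨s, e, g, D, -, -, -, hU, -⟩ := h
  rw [hU]
  exact fun x hx => hx.1

theorem IsStage.surface_subset (h : IsStage S S') : S'.surface ⊆ S.surface := by
  have hU := h.U_subset
  obtain ⟨s, e, g, D, -, -, -, -, -, -, hT, -⟩ := h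
  intro x hx
  exact ⟨hU hx.1.1, fun a => ((hT x hx.1.1).1 hx.2 a).1⟩

theorem IsStage.l_le (h : IsStage S S') : S'.l ≤ S.l := by
  obtain ⟨s, e, -⟩ := h
  have := Fintype.card_congr e
  simp at this
  omega

/-- A stage that eliminates no multipliers and does not lower the dimension starts from a system
without further compatibility conditions. -/
theorem IsStage.isComplete (h : IsStage S S') (hconn : IsConnected S.surface) (hl : S'.l = S.l)
    (hrank : ∀ x ∈ S'.surface, (S.jacobi x).rank = (S'.jacobi x).rank) : S.IsComplete := by
  have hsub := h.surface_subset
  obtain ⟨s, e, g, D, hD, hM, -, hU, hV, -, hT, ⟨x₀, hx₀⟩⟩ := h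
  -- Since `s + S'.l = S.l`, nothing is eliminated; hence the drift is unchanged on the new domain
  -- and the rank of `(Z_α T_a)` on the surface is zero.
  obtain rfl : s = 0 := by
    have := Fintype.card_congr e
    simp at this
    omega
  refine ⟨hconn.nonempty, fun a => ?_, fun α a x hx => ?_⟩
  -- Near `x₀` both surfaces coincide, and the secondary constraints hold on the new one; unique
  -- continuation spreads `V T_a = 0` to the whole old surface.
  · refine S.eqOn_zero_of_eventually hconn.isPreconnected (S.analytic_V.alongField (S.analytic_T a))
      (hsub hx₀) ?_
    filter_upwards [eventually_mem_surface_of_rank_eq hsub hx₀ (hrank x₀ hx₀)] with y hy hyS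
    have hy' := hy hyS
    have := ((hT y hy'.1.1).1 hy'.2 a).2
    have hVy := hV y hy'.1.1
    simp only [Finset.univ_eq_empty, Finset.sum_empty, sub_zero] at hVy
    rwa [alongField, hVy] at this
  · have h0 : (S.conservationMatrix x).rank = 0 := Nat.le_zero.1 (hM x hx)
    have h1 : (S.conservationMatrix x).mulVecLin = 0 := by
      rw [Matrix.rank, Submodule.finrank_eq_zero, LinearMap.range_eq_bot] at h0
      exact h0
    have h2 := congrFun (LinearMap.congr_fun h1 (Pi.single a 1)) α
    simpa [conservationMatrix] using h2

/-- The number of multipliers plus the dimension `n - rank J` of the surface is nonincreasing along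
a run. At a minimum neither summand changes in the next stage, so `IsStage.isComplete` applies. -/
theorem IsRegular.exists_completeForm (hS : S.IsRegular) : ∃ C, IsCompleteFormOf C S := by
  obtain ⟨run, h0, hstage, hconn⟩ := hS
  have hreach : ∀ k, S.Reaches (run k) := by
    intro k
    induction k with
    | zero => rw [h0]; exact Relation.ReflTransGen.refl
    | succ k ih => exact ih.tail (hstage k)
  choose pt hpt using fun k => (hconn k).nonempty
  have hanti : ∀ k, (run (k + 1)).l + (n - ((run (k + 1)).jacobi (pt (k + 1))).rank) ≤
      (run k).l + (n - ((run k).jacobi (pt k)).rank) := by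
    intro k
    have h1 := (hstage k).l_le
    have h2 := rank_jacobi_le_of_surface_subset (hstage k).surface_subset (hpt (k + 1))
    rw [rank_jacobi_eq ((hstage k).surface_subset (hpt (k + 1))) (hpt k)] at h2
    omega
  let d : ℕ → ℕ := fun k => (run k).l + (n - ((run k).jacobi (pt k)).rank)
  obtain ⟨K, hK⟩ : ∃ K, ∀ k, d K ≤ d k := ⟨Function.argmin d, fun k => Function.argmin_le d k⟩
  have hK1 : d K = d (K + 1) := le_antisymm (hK (K + 1)) (hanti K)
  simp only [d] at hK1
  have h1 := (hstage K).l_le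
  have h2 := rank_jacobi_le_of_surface_subset (hstage K).surface_subset (hpt (K + 1))
  rw [rank_jacobi_eq ((hstage K).surface_subset (hpt (K + 1))) (hpt K)] at h2
  have h3 := (run K).finrank_ker_constraintDeriv (pt K)
  have h4 := (run (K + 1)).finrank_ker_constraintDeriv (pt (K + 1))
  refine ⟨run K, hreach K, (hstage K).isComplete (hconn K) (by omega) fun x hx => ?_, hconn K⟩
  rw [rank_jacobi_eq ((hstage K).surface_subset hx) (hpt K), rank_jacobi_eq hx (hpt (K + 1))]
  omega

/-- A solution remaining in the domain of the next stage solves the next system. -/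
theorem IsStage.exists_isSolution (h : IsStage S S') {I : Set ℝ} (hI : IsOpen I)
    {x : ℝ → PhaseSpace n} {lam : ℝ → Fin S.l → ℝ} (hsol : S.IsSolution I x lam)
    (hx : ∀ t ∈ I, x t ∈ S'.regularDomain) : ∃ lam', S'.IsSolution I x lam' := by
  obtain ⟨s, e, g, D, hD, hM, -, hU, hV, hZ, hT, -⟩ := h
  refine ⟨fun t α => lam t (e (Sum.inr α)), fun t ht => ?_⟩
  have hyU := (hx t ht).1
  obtain ⟨hyS, hder⟩ := hsol t ht
  have hdet : (D (x t)).det ≠ 0 := by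
    rw [hU] at hyU
    exact hyU.2
  have hunit : IsUnit (D (x t)).det := isUnit_iff_ne_zero.2 hdet
  set y := x t with hy
  set M := S.conservationMatrix y with hMdef
  have hZM : ∀ α a, fderiv ℝ (S.T a) y (S.Z α y) = M α a := fun α a => rfl
  -- Conservation of the constraints, obtained by differentiating `T_a (x t) = 0`. Its components
  -- with index `g B` are solved for the multipliers `λ^A` in `hlam`.
  have hcons : ∀ a, fderiv ℝ (S.T a) y (S.V y + ∑ α, lam t α • S.Z α y) = 0 := by
    intro a
    have h1 : HasDerivAt (fun t => S.T a (x t))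
        (fderiv ℝ (S.T a) y (S.V y + ∑ α, lam t α • S.Z α y)) t :=
      ((S.analytic_T a y (S.surface_subset_U hyS)).differentiableAt.hasFDerivAt).comp_hasDerivAt
        t hder
    have h2 : (fun t => S.T a (x t)) =ᶠ[𝓝 t] fun _ => 0 := by
      filter_upwards [hI.mem_nhds ht] with t' ht'
      exact (hsol t' ht').1.2 a
    exact h1.unique ((hasDerivAt_const t (0 : ℝ)).congr_of_eventuallyEq h2)
  have hrow : ∀ i a, M i a =
      ∑ A, ∑ B, M i (g B) * (D y)⁻¹ B A * M (e (Sum.inl A)) a := fun i a => by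
    rw [hD] at hdet ⊢
    exact M.row_eq_of_rank_le (fun A => e (Sum.inl A)) g hdet (hM y hyS) i a
  have hsplit : ∑ α, lam t α • S.Z α y = ∑ A, lam t (e (Sum.inl A)) • S.Z (e (Sum.inl A)) y +
      ∑ α, lam t (e (Sum.inr α)) • S.Z (e (Sum.inr α)) y := by
    rw [← e.sum_comp, Fintype.sum_sum_type]
  have hlam : ∀ A, lam t (e (Sum.inl A)) = - ∑ B, (fderiv ℝ (S.T (g B)) y (S.V y) +
      ∑ α, lam t (e (Sum.inr α)) * M (e (Sum.inr α)) (g B)) * (D y)⁻¹ B A := by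
    have h1 : Matrix.vecMul (fun A => lam t (e (Sum.inl A))) (D y) =
        fun B => -(fderiv ℝ (S.T (g B)) y (S.V y) +
          ∑ α, lam t (e (Sum.inr α)) * M (e (Sum.inr α)) (g B)) := by
      funext B
      have := hcons (g B)
      rw [hsplit] at this
      simp only [map_add, map_sum, map_smul, smul_eq_mul, hZM] at this
      simp only [Matrix.vecMul, dotProduct, hD, Matrix.submatrix_apply]
      linarith
    have h2 := congrArg (fun w => Matrix.vecMul w (D y)⁻¹) h1
    simp only [Matrix.vecMul_vecMul, Matrix.mul_nonsing_inv _ hunit, Matrix.vecMul_one] at h2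
    intro A
    rw [congrFun h2 A]
    simp only [Matrix.vecMul, dotProduct, neg_mul, Finset.sum_neg_distrib]
  have hvel : S.V y + ∑ α, lam t α • S.Z α y =
      S'.V y + ∑ α, lam t (e (Sum.inr α)) • S'.Z α y := by
    rw [hsplit, hV y hyU]
    simp only [hZ _ y hyU, smul_sub, Finset.sum_sub_distrib]
    have h1 : ∑ A, lam t (e (Sum.inl A)) • S.Z (e (Sum.inl A)) y =
        - (∑ A, ∑ B, (alongField S.V (S.T (g B)) y * (D y)⁻¹ B A) • S.Z (e (Sum.inl A)) y) -
        ∑ α, lam t (e (Sum.inr α)) • ∑ A, ∑ B,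
          (alongField (S.Z (e (Sum.inr α))) (S.T (g B)) y * (D y)⁻¹ B A) •
            S.Z (e (Sum.inl A)) y := by
      simp only [Finset.smul_sum]
      rw [Finset.sum_comm (s := Finset.univ (α := Fin S'.l)), ← Finset.sum_neg_distrib,
        ← Finset.sum_sub_distrib]
      refine Finset.sum_congr rfl fun A _ => ?_
      rw [Finset.sum_comm (s := Finset.univ (α := Fin S'.l)), hlam A, ← Finset.sum_neg_distrib,
        ← Finset.sum_neg_distrib, ← Finset.sum_sub_distrib, Finset.sum_smul]
      refine Finset.sum_congr rfl fun B _ => ?_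
      simp only [smul_smul, ← Finset.sum_smul, ← neg_smul, ← sub_smul]
      congr 1
      rw [add_mul, Finset.sum_mul, neg_add]
      simp only [alongField, hZM, mul_assoc, sub_eq_add_neg]
    rw [h1]
    abel
  -- Because the minor has the full rank of `M`, subtracting the combination of its rows annihilates
  -- every column. Conservation then reduces to `V' T_a = 0`, which yields the new constraints.
  have hZ0 : ∀ α a, fderiv ℝ (S.T a) y (S'.Z α y) = 0 := by
    intro α a
    rw [hZ α y hyU]
    simp only [map_sub, map_sum, map_smul, smul_eq_mul, alongField, hZM]
    rw [hrow (e (Sum.inr α)) a, sub_self]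
  have hT0 : ∀ a, S'.T a y = 0 := by
    refine (hT y hyU).2 fun a => ⟨hyS.2 a, ?_⟩
    have := hcons a
    rw [hvel] at this
    simpa [hZ0, alongField] using this
  refine ⟨⟨hx t ht, hT0⟩, ?_⟩
  rw [← hvel]
  exact hder

/-- Only the last regular domain has to be assumed: the domain of each stage is contained in the
regular domain of the preceding one. -/
theorem Reaches.exists_isSolution (h : S.Reaches S') {I : Set ℝ} (hI : IsOpen I)
    {x : ℝ → PhaseSpace n} {lam : ℝ → Fin S.l → ℝ} (hsol : S.IsSolution I x lam)
    (hx : ∀ t ∈ I, x t ∈ S'.regularDomain) : ∃ lam', S'.IsSolution I x lam' := by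
  induction h with
  | refl => exact ⟨lam, hsol⟩
  | tail _ hst ih =>
    obtain ⟨lam', hsol'⟩ := ih fun t ht => hst.U_subset (hx t ht).1
    exact hst.exists_isSolution hI hsol' hx

end LocalSystem

/-! ### On-shell functions, fractions and distributions. -/

section OnShellAlgebra

variable {n : ℕ} {U M : Set (PhaseSpace n)}

/-- The class of an analytic function in the field of fractions. -/
def toFrac (U M : Set (PhaseSpace n)) : analyticRing U →+* OnShellField U M :=
  (algebraMap (OnShellRing U M) (OnShellField U M)).comp (onShell U M)

theorem toFrac_eq_zero {f : analyticRing U} :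
    toFrac U M f = 0 ↔ ∀ x ∈ M, (f : PhaseSpace n → ℝ) x = 0 := by
  have hinj : Function.Injective (algebraMap (OnShellRing U M) (OnShellField U M)) :=
    IsFractionRing.injective _ _
  show algebraMap (OnShellRing U M) (OnShellField U M) (onShell U M f) = 0 ↔ _
  rw [map_eq_zero_iff _ hinj]
  exact Ideal.Quotient.eq_zero_iff_mem

theorem toFrac_eq_iff {f g : analyticRing U} :
    toFrac U M f = toFrac U M g ↔ Set.EqOn (f : PhaseSpace n → ℝ) g M := by
  rw [← sub_eq_zero, ← map_sub, toFrac_eq_zero]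
  exact forall₂_congr fun x _ => sub_eq_zero

/-- Finitely many fractions have a common nontrivial denominator. -/
theorem exists_common_denominator {ι : Type*} [Finite ι] (c : ι → OnShellField U M) :
    ∃ (b : analyticRing U) (a : ι → analyticRing U), IsUnit (toFrac U M b) ∧
      ∀ i, toFrac U M b * c i = toFrac U M (a i) := by
  obtain ⟨b, hb⟩ := IsLocalization.exist_integer_multiples_of_finite
    (nonZeroDivisors (OnShellRing U M)) c
  obtain ⟨b', hb'⟩ := Ideal.Quotient.mk_surjective (I := trivialIdeal U M) (b : OnShellRing U M)
  choose d hd using hb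
  choose a ha using fun i => Ideal.Quotient.mk_surjective (I := trivialIdeal U M) (d i)
  refine ⟨b', a, ?_, fun i => ?_⟩
  · have h : toFrac U M b' = algebraMap (OnShellRing U M) (OnShellField U M) b :=
      congrArg (algebraMap (OnShellRing U M) (OnShellField U M)) hb'
    rw [h]
    exact IsLocalization.map_units _ b
  · have h : toFrac U M b' = algebraMap (OnShellRing U M) (OnShellField U M) b :=
      congrArg (algebraMap (OnShellRing U M) (OnShellField U M)) hb'
    have h' : toFrac U M (a i) = algebraMap (OnShellRing U M) (OnShellField U M) (d i) :=
      congrArg (algebraMap (OnShellRing U M) (OnShellField U M)) (ha i)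
    rw [h, h', hd i]
    exact (Algebra.smul_def _ _).symm

theorem AnalyticOnNhd.component {X : PhaseSpace n → PhaseSpace n} (hX : AnalyticOnNhd ℝ X U)
    (i : Fin n) : AnalyticOnNhd ℝ (fun x => X x i) U := fun x hx =>
  analyticAt_pi_iff.1 (hX x hx) i

theorem fieldClass_apply {X : PhaseSpace n → PhaseSpace n} (hX : AnalyticOnNhd ℝ X U)
    (i : Fin n) : fieldClass U M X hX i = toFrac U M ⟨fun x => X x i, hX.component i⟩ := rfl

theorem fieldClass_eq_iff {X Y : PhaseSpace n → PhaseSpace n} (hX : AnalyticOnNhd ℝ X U)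
    (hY : AnalyticOnNhd ℝ Y U) :
    fieldClass U M X hX = fieldClass U M Y hY ↔ Set.EqOn X Y M := by
  constructor
  · intro h x hx
    funext i
    exact toFrac_eq_iff.1 (congrFun h i) hx
  · intro h
    funext i
    exact toFrac_eq_iff.2 fun x hx => congrFun (h hx) i

theorem fieldClass_add {X Y : PhaseSpace n → PhaseSpace n} (hX : AnalyticOnNhd ℝ X U)
    (hY : AnalyticOnNhd ℝ Y U) :
    fieldClass U M (X + Y) (hX.add hY) = fieldClass U M X hX + fieldClass U M Y hY := by
  funext i
  exact map_add (toFrac U M) ⟨_, hX.component i⟩ ⟨_, hY.component i⟩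

theorem fieldClass_smul {f : PhaseSpace n → ℝ} {X : PhaseSpace n → PhaseSpace n}
    (hf : AnalyticOnNhd ℝ f U) (hX : AnalyticOnNhd ℝ X U) :
    fieldClass U M (fun x => f x • X x) (hf.smul hX) =
      toFrac U M ⟨f, hf⟩ • fieldClass U M X hX := by
  funext i
  exact map_mul (toFrac U M) ⟨f, hf⟩ ⟨_, hX.component i⟩

theorem AnalyticOnNhd.sum_smul {ι : Type*} [Fintype ι] {f : ι → PhaseSpace n → ℝ}
    {X : ι → PhaseSpace n → PhaseSpace n}
    (hf : ∀ i, AnalyticOnNhd ℝ (f i) U) (hX : ∀ i, AnalyticOnNhd ℝ (X i) U) :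
    AnalyticOnNhd ℝ (fun x => ∑ i, f i x • X i x) U :=
  Finset.univ.analyticOnNhd_fun_sum fun i _ => (hf i).smul (hX i)

theorem fieldClass_sum_smul {ι : Type*} [Fintype ι] {f : ι → PhaseSpace n → ℝ}
    {X : ι → PhaseSpace n → PhaseSpace n}
    (hf : ∀ i, AnalyticOnNhd ℝ (f i) U) (hX : ∀ i, AnalyticOnNhd ℝ (X i) U) :
    fieldClass U M (fun x => ∑ i, f i x • X i x) (AnalyticOnNhd.sum_smul hf hX) =
      ∑ i, toFrac U M ⟨f i, hf i⟩ • fieldClass U M (X i) (hX i) := by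
  funext j
  have h : (⟨fun x => (∑ i, f i x • X i x) j, (AnalyticOnNhd.sum_smul hf hX).component j⟩ :
      analyticRing U) = ∑ i, ⟨f i, hf i⟩ * ⟨_, (hX i).component j⟩ := by
    apply Subtype.ext
    funext x
    simp [Finset.sum_apply]
  rw [fieldClass_apply, h, map_sum, Finset.sum_apply]
  exact Finset.sum_congr rfl fun i _ => map_mul _ _ _

/-- Elements of a distribution are multiples of classes of analytic fields. -/
theorem exists_smul_eq_fieldClass {ι : Type*} [Finite ι] (w : ι → Fin n → OnShellField U M) :
    ∃ (b : analyticRing U) (X : ι → PhaseSpace n → PhaseSpace n)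
      (hX : ∀ i, AnalyticOnNhd ℝ (X i) U), IsUnit (toFrac U M b) ∧
      ∀ i, toFrac U M b • w i = fieldClass U M (X i) (hX i) := by
  obtain ⟨b, a, hb, ha⟩ := exists_common_denominator fun p : ι × Fin n => w p.1 p.2
  exact ⟨b, fun i x j => (a (i, j) : PhaseSpace n → ℝ) x,
    fun i => AnalyticOnNhd.pi fun j => (a (i, j)).2, hb, fun i => funext fun j => ha (i, j)⟩

section MemDist

variable {P Q : VFDistribution U M} {X Y : PhaseSpace n → PhaseSpace n}

theorem MemDist.mono (h : P ≤ Q) (hX : MemDist P X) : MemDist Q X :=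
  ⟨hX.1, h hX.2⟩

theorem MemDist.add (hX : MemDist P X) (hY : MemDist P Y) : MemDist P (X + Y) :=
  ⟨hX.1.add hY.1, by rw [fieldClass_add hX.1 hY.1]; exact P.add_mem hX.2 hY.2⟩

theorem MemDist.smul {f : PhaseSpace n → ℝ} (hf : AnalyticOnNhd ℝ f U) (hX : MemDist P X) :
    MemDist P fun x => f x • X x :=
  ⟨hf.smul hX.1, by rw [fieldClass_smul hf hX.1]; exact P.smul_mem _ hX.2⟩

theorem MemDist.congr (hX : MemDist P X) (hY : AnalyticOnNhd ℝ Y U) (h : Set.EqOn X Y M) :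
    MemDist P Y :=
  ⟨hY, by rw [← (fieldClass_eq_iff hX.1 hY).2 h]; exact hX.2⟩

theorem MemDist.of_smul {f : PhaseSpace n → ℝ} (hf : AnalyticOnNhd ℝ f U)
    (hf0 : IsUnit (toFrac U M ⟨f, hf⟩)) (hX : AnalyticOnNhd ℝ X U)
    (h : MemDist P fun x => f x • X x) : MemDist P X := by
  refine ⟨hX, ?_⟩
  have h2 := h.2
  rw [fieldClass_smul hf hX] at h2
  exact (P.smul_mem_iff_of_isUnit hf0).1 h2

/-- A class of analytic fields stable under linear combinations with analytic coefficients, under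
changes by trivial fields and under division by nontrivial functions defines a distribution. -/
theorem exists_distribution (K : (PhaseSpace n → PhaseSpace n) → Prop) (hzero : K 0)
    (hadd : ∀ X Y, AnalyticOnNhd ℝ X U → AnalyticOnNhd ℝ Y U → K X → K Y → K (X + Y))
    (hsmul : ∀ (f : PhaseSpace n → ℝ) X, AnalyticOnNhd ℝ f U → AnalyticOnNhd ℝ X U → K X →
      K fun x => (f x : ℝ) • X x)
    (hcongr : ∀ X Y, AnalyticOnNhd ℝ X U → AnalyticOnNhd ℝ Y U → Set.EqOn X Y M → K X → K Y)
    (hdiv : ∀ (f : PhaseSpace n → ℝ) X, ∀ hf : AnalyticOnNhd ℝ f U, IsUnit (toFrac U M ⟨f, hf⟩) →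
      AnalyticOnNhd ℝ X U → K (fun x => f x • X x) → K X) :
    ∃ P : VFDistribution U M, ∀ X, MemDist P X ↔ AnalyticOnNhd ℝ X U ∧ K X := by
  -- The vectors that become, after multiplication by some unit denominator, the class of a field in
  -- `K`. Invariance under division and under trivial changes ensures that no new analytic fields
  -- enter.
  let P : VFDistribution U M :=
    { carrier := {w | ∃ b : analyticRing U, IsUnit (toFrac U M b) ∧
        ∃ (X : PhaseSpace n → PhaseSpace n) (hX : AnalyticOnNhd ℝ X U),
          toFrac U M b • w = fieldClass U M X hX ∧ K X}
      zero_mem' := ⟨1, by simp, 0, analyticOnNhd_const, by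
        rw [smul_zero]
        funext i
        exact (map_zero (toFrac U M)).symm, hzero⟩
      add_mem' := by
        rintro w w' ⟨b, hb, X, hX, hw, hK⟩ ⟨b', hb', X', hX', hw', hK'⟩
        refine ⟨b * b', by rw [map_mul]; exact hb.mul hb', _, (b'.2.smul hX).add (b.2.smul hX'), ?_,
          hadd _ _ (b'.2.smul hX) (b.2.smul hX') (hsmul _ _ b'.2 hX hK) (hsmul _ _ b.2 hX' hK')⟩
        rw [fieldClass_add (b'.2.smul hX) (b.2.smul hX'), fieldClass_smul b'.2 hX,
          fieldClass_smul b.2 hX', ← hw, ← hw', map_mul, smul_add,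
          smul_smul, smul_smul, mul_comm (toFrac U M b)]
      smul_mem' := by
        rintro c w ⟨b, hb, X, hX, hw, hK⟩
        obtain ⟨d, a, hd, ha⟩ := exists_common_denominator fun _ : Unit => c
        refine ⟨d * b, by rw [map_mul]; exact hd.mul hb, _, (a ()).2.smul hX, ?_,
          hsmul _ _ (a ()).2 hX hK⟩
        rw [fieldClass_smul (a ()).2 hX, ← hw, map_mul, smul_smul, smul_smul]
        congr 1
        have := ha ()
        calc toFrac U M d * toFrac U M b * c = toFrac U M d * c * toFrac U M b := by ring
          _ = _ := by rw [this] }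
  refine ⟨P, fun X => ⟨?_, ?_⟩⟩
  · rintro ⟨hX, b, hb, Y, hY, hXY, hK⟩
    refine ⟨hX, hdiv _ _ b.2 hb hX (hcongr _ _ hY (b.2.smul hX) ?_ hK)⟩
    rw [← fieldClass_eq_iff (U := U) hY (b.2.smul hX), fieldClass_smul b.2 hX]
    exact hXY.symm
  · rintro ⟨hX, hK⟩
    exact ⟨hX, 1, by simp, X, hX, by simp, hK⟩

end MemDist

end OnShellAlgebra

/-! ### Lie closures and the gauge distribution. -/

section Involutive

open VectorField

variable {n : ℕ} {U M : Set (PhaseSpace n)} {X Y V : PhaseSpace n → PhaseSpace n}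

theorem AnalyticOnNhd.lieBracket (hX : AnalyticOnNhd ℝ X U) (hY : AnalyticOnNhd ℝ Y U) :
    AnalyticOnNhd ℝ (lieBracket ℝ X Y) U := fun x hx => by
  have key : ∀ {A B : PhaseSpace n → PhaseSpace n}, AnalyticAt ℝ A x → AnalyticAt ℝ B x →
      AnalyticAt ℝ (fun y => fderiv ℝ A y (B y)) x := fun {A B} hA hB =>
    (ContinuousLinearMap.analyticAt_bilinear
      (ContinuousLinearMap.id ℝ (PhaseSpace n →L[ℝ] PhaseSpace n))
      (fderiv ℝ A x, B x)).comp₂ hA.fderiv hB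
  exact (key (hY x hx) (hX x hx)).sub (key (hX x hx) (hY x hx))

theorem AnalyticOnNhd.iterate_lieBracket (hV : AnalyticOnNhd ℝ V U) (hX : AnalyticOnNhd ℝ X U)
    (j : ℕ) : AnalyticOnNhd ℝ ((fun W => VectorField.lieBracket ℝ V W)^[j] X) U := by
  induction j with
  | zero => exact hX
  | succ j ih => rw [Function.iterate_succ_apply']; exact hV.lieBracket ih

theorem alongField_lieBracket (hX : AnalyticOnNhd ℝ X U) (hY : AnalyticOnNhd ℝ Y U)
    {f : PhaseSpace n → ℝ} (hf : AnalyticOnNhd ℝ f U) {x : PhaseSpace n} (hx : x ∈ U) :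
    alongField (lieBracket ℝ X Y) f x =
      alongField X (alongField Y f) x - alongField Y (alongField X f) x :=
  fderiv_apply_lieBracket (n := ω) (hf x hx).contDiffAt (by simp)
    (hY x hx).differentiableAt (hX x hx).differentiableAt

theorem PreservesTrivial.lieBracket (hMU : M ⊆ U) (hXa : AnalyticOnNhd ℝ X U)
    (hYa : AnalyticOnNhd ℝ Y U) (hX : PreservesTrivial U M X) (hY : PreservesTrivial U M Y) :
    PreservesTrivial U M (lieBracket ℝ X Y) := by
  intro f hf hf0 x hx
  rw [alongField_lieBracket hXa hYa hf (hMU hx),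
    hX _ (hYa.alongField hf) (hY f hf hf0) x hx, hY _ (hXa.alongField hf) (hX f hf hf0) x hx,
    sub_zero]

/-- The commutator with a field preserving the trivial ideal is well defined modulo trivial
fields. -/
theorem PreservesTrivial.lieBracket_eqOn (hMU : M ⊆ U) (hV : PreservesTrivial U M V)
    (hX : AnalyticOnNhd ℝ X U) (hY : AnalyticOnNhd ℝ Y U) (h : Set.EqOn X Y M) :
    Set.EqOn (VectorField.lieBracket ℝ V X) (VectorField.lieBracket ℝ V Y) M := by
  intro x hx
  have hdX := (hX x (hMU hx)).differentiableAt
  have hdY := (hY x (hMU hx)).differentiableAt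
  -- The components of `X - Y` are trivial functions, so `V` annihilates them on `M`.
  have h1 : fderiv ℝ X x (V x) = fderiv ℝ Y x (V x) := by
    funext i
    have h2 := hV (fun x => X x i - Y x i) ((hX.component i).sub (hY.component i))
      (fun y hy => by rw [h hy, sub_self]) x hx
    have h3 : HasFDerivAt (fun x => X x i - Y x i)
        ((ContinuousLinearMap.proj i).comp (fderiv ℝ X x - fderiv ℝ Y x)) x :=
      (ContinuousLinearMap.proj (R := ℝ) (φ := fun _ : Fin n => ℝ) i).hasFDerivAt.comp x
        (hdX.hasFDerivAt.sub hdY.hasFDerivAt)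
    rw [alongField, h3.fderiv] at h2
    exact sub_eq_zero.1 h2
  show fderiv ℝ X x (V x) - fderiv ℝ V x (X x) = fderiv ℝ Y x (V x) - fderiv ℝ V x (Y x)
  rw [h1, h hx]

theorem IsInvolutive.sInf {D : Set (VFDistribution U M)} (h : ∀ P ∈ D, IsInvolutive P)
    (hne : D.Nonempty) : IsInvolutive (sInf D) := by
  intro X Y hX hY hXP hYP
  have hmem : ∀ P ∈ D, MemDist P (VectorField.lieBracket ℝ X Y) := fun P hP =>
    h P hP X Y hX hY (hXP.mono (sInf_le hP)) (hYP.mono (sInf_le hP))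
  obtain ⟨P, hP⟩ := hne
  exact ⟨(hmem P hP).1, Submodule.mem_sInf.2 fun Q hQ => (hmem Q hQ).2⟩

theorem isInvolutive_top : IsInvolutive (⊤ : VFDistribution U M) := fun _ _ _ _ hX hY =>
  ⟨hX.1.lieBracket hY.1, trivial⟩

variable {G : Set (PhaseSpace n → PhaseSpace n)}

theorem isInvolutive_lieClosure (hG : ∀ X ∈ G, AnalyticOnNhd ℝ X U) :
    IsInvolutive (lieClosure U M G) :=
  IsInvolutive.sInf (fun _ hP => hP.1) ⟨⊤, isInvolutive_top, fun X hX => ⟨hG X hX, trivial⟩⟩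

theorem memDist_lieClosure (hX : X ∈ G) (hXa : AnalyticOnNhd ℝ X U) :
    MemDist (lieClosure U M G) X :=
  ⟨hXa, Submodule.mem_sInf.2 fun _ hP => (hP.2 X hX).2⟩

theorem lieClosure_le {P : VFDistribution U M} (hP : IsInvolutive P) (h : ∀ X ∈ G, MemDist P X) :
    lieClosure U M G ≤ P :=
  sInf_le ⟨hP, h⟩

section Gauge

variable {l : ℕ} {Z : Fin l → PhaseSpace n → PhaseSpace n}

theorem gaugeFiltration_mono : Monotone (gaugeFiltration U M V Z) := fun _ _ hk =>
  sInf_le_sInf fun _ hP => ⟨hP.1, fun X ⟨j, α, hj, hX⟩ => hP.2 X ⟨j, α, hj.trans hk, hX⟩⟩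

theorem gaugeDistribution_le {P : VFDistribution U M} (hP : IsInvolutive P)
    (h : ∀ j α, MemDist P ((fun W => lieBracket ℝ V W)^[j] (Z α))) :
    gaugeDistribution U M V Z ≤ P :=
  iSup_le fun _ => lieClosure_le hP fun _ ⟨j, α, _, hX⟩ => hX ▸ h j α

variable (hV : AnalyticOnNhd ℝ V U) (hZ : ∀ α, AnalyticOnNhd ℝ (Z α) U)
include hV hZ

theorem memDist_gaugeDistribution (j : ℕ) (α : Fin l) :
    MemDist (gaugeDistribution U M V Z) ((fun W => lieBracket ℝ V W)^[j] (Z α)) :=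
  MemDist.mono (le_iSup (gaugeFiltration U M V Z) j) <|
    memDist_lieClosure (G := {X | ∃ (i : ℕ) (β : Fin l), i ≤ j ∧
      X = (fun W => lieBracket ℝ V W)^[i] (Z β)}) ⟨j, α, le_rfl, rfl⟩
      (hV.iterate_lieBracket (hZ α) j)

/-- The filtration increases, so any two fields of its union lie in a common member, and each member
is involutive. -/
theorem isInvolutive_gaugeDistribution : IsInvolutive (gaugeDistribution U M V Z) := by
  intro X Y hX hY hXP hYP
  have hdir : Directed (· ≤ ·) (gaugeFiltration U M V Z) := gaugeFiltration_mono.directed_le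
  obtain ⟨i, hi⟩ := (Submodule.mem_iSup_of_directed _ hdir).1 hXP.2
  obtain ⟨j, hj⟩ := (Submodule.mem_iSup_of_directed _ hdir).1 hYP.2
  have hinv : IsInvolutive (gaugeFiltration U M V Z (max i j)) := by
    refine isInvolutive_lieClosure ?_
    rintro _ ⟨j, α, -, rfl⟩
    exact hV.iterate_lieBracket (hZ α) j
  refine (hinv X Y hX hY ⟨hXP.1, ?_⟩ ⟨hYP.1, ?_⟩).mono (le_iSup (gaugeFiltration U M V Z) _)
  · exact gaugeFiltration_mono (le_max_left i j) hi
  · exact gaugeFiltration_mono (le_max_right i j) hj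

/-- The drift preserves the gauge distribution. -/
theorem MemDist.lieBracket_drift (hMU : M ⊆ U) (hVp : PreservesTrivial U M V)
    (hX : MemDist (gaugeDistribution U M V Z) X) :
    MemDist (gaugeDistribution U M V Z) (lieBracket ℝ V X) := by
  set P := gaugeDistribution U M V Z with hPdef
  have hinv : IsInvolutive P := isInvolutive_gaugeDistribution hV hZ
  have hzero : MemDist P 0 := ⟨analyticOnNhd_const, by
    convert P.zero_mem using 1
    funext i
    exact map_zero (toFrac U M)⟩
  -- The Leibniz rule makes the fields of `P` with `[V, X]` in `P` a distribution `Q`. It suffices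
  -- to show `P ≤ Q`, which follows by minimality.
  obtain ⟨Q, hQ⟩ := exists_distribution (U := U) (M := M)
    (fun X => MemDist P X ∧ MemDist P (lieBracket ℝ V X))
    ⟨hzero, by rw [lieBracket_zero_right]; exact hzero⟩
    (fun X Y hXa hYa hX hY => ⟨hX.1.add hY.1,
      (hX.2.add hY.2).congr (hV.lieBracket (hXa.add hYa)) fun x hx =>
        (lieBracket_add_right (hXa x (hMU hx)).differentiableAt
          (hYa x (hMU hx)).differentiableAt).symm⟩)
    (fun f X hf hXa hX => ⟨hX.1.smul hf,
      ((hX.1.smul (hV.alongField hf)).add (hX.2.smul hf)).congr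
        (hV.lieBracket (hf.smul hXa)) fun x hx =>
          (lieBracket_smul_right (hf x (hMU hx)).differentiableAt
            (hXa x (hMU hx)).differentiableAt).symm⟩)
    (fun X Y hXa hYa h hX => ⟨hX.1.congr hYa h,
      hX.2.congr (hV.lieBracket hYa) (hVp.lieBracket_eqOn hMU hXa hYa h)⟩)
    (fun f X hf hfu hXa hX => by
      have hXP : MemDist P X := hX.1.of_smul hf hfu hXa
      refine ⟨hXP, MemDist.of_smul hf hfu (hV.lieBracket hXa) ?_⟩
      -- Division by `f` uses `f [V, X] = [V, f X] - (V f) X`.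
      have hneg : MemDist P fun x => (-(1 : ℝ)) • (fun x => alongField V f x • X x) x :=
        (hXP.smul (hV.alongField hf)).smul analyticOnNhd_const
      refine (hX.2.add hneg).congr (hf.smul (hV.lieBracket hXa)) fun x hx => ?_
      have := lieBracket_smul_right (V := V) (hf x (hMU hx)).differentiableAt
        (hXa x (hMU hx)).differentiableAt
      simp only [Pi.add_apply, this, alongField]
      module)
  have hle : P ≤ Q := by
    refine gaugeDistribution_le ?_ fun j α => ?_
    · intro X Y hXp hYp hX hY
      obtain ⟨hXa, hX1, hX2⟩ := (hQ X).1 hX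
      obtain ⟨hYa, hY1, hY2⟩ := (hQ Y).1 hY
      refine (hQ _).2 ⟨hXa.lieBracket hYa, hinv X Y hXp hYp hX1 hY1, ?_⟩
      -- Jacobi: `[V, [X, Y]] = [[V, X], Y] + [X, [V, Y]]`. Involutivity of `P` applies to both
      -- terms because `[V, X]` and `[V, Y]` again preserve the trivial ideal.
      have h1 := hinv _ Y (hVp.lieBracket hMU hV hXa hXp) hYp hX2 hY1
      have h2 := hinv X _ hXp (hVp.lieBracket hMU hV hYa hYp) hX1 hY2
      refine (h1.add h2).congr (hV.lieBracket (hXa.lieBracket hYa)) fun x hx => ?_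
      exact (leibniz_identity_lieBracket (n := ω) (by simp) (hV x (hMU hx)).contDiffAt
        (hXa x (hMU hx)).contDiffAt (hYa x (hMU hx)).contDiffAt).symm
    · refine (hQ _).2 ⟨hV.iterate_lieBracket (hZ α) j, memDist_gaugeDistribution hV hZ j α, ?_⟩
      -- The commutator of `V` with a generator is the next generator; this is why the limit of the
      -- filtration is needed.
      have := memDist_gaugeDistribution (M := M) hV hZ (j + 1) α
      rwa [Function.iterate_succ_apply'] at this
  exact ((hQ X).1 (hX.mono hle)).2.2

end Gauge

end Involutive

/-! ### Analytic bases and common denominators. -/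

section Basis

variable {n : ℕ} {U M : Set (PhaseSpace n)}

theorem spanFields_eq_span_range {r : ℕ} {Z : Fin r → PhaseSpace n → PhaseSpace n}
    (hZ : ∀ α, AnalyticOnNhd ℝ (Z α) U) :
    spanFields U M Z = Submodule.span (OnShellField U M)
      (Set.range fun α => fieldClass U M (Z α) (hZ α)) := by
  rw [spanFields]
  congr 1
  ext w
  exact ⟨fun ⟨α, _, hw⟩ => ⟨α, hw.symm⟩, fun ⟨α, hw⟩ => ⟨α, hZ α, hw.symm⟩⟩

/-- Every distribution has a basis represented by fields analytic on `U`. -/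
theorem exists_analytic_basis [IsDomain (OnShellRing U M)] (P : VFDistribution U M) :
    ∃ (r : ℕ) (Z : Fin r → PhaseSpace n → PhaseSpace n) (hZ : ∀ α, AnalyticOnNhd ℝ (Z α) U),
      LinearIndependent (OnShellField U M) (fun α => fieldClass U M (Z α) (hZ α)) ∧
        spanFields U M Z = P := by
  let B := Module.finBasis (OnShellField U M) P
  obtain ⟨b, Z, hZ, hb, hw⟩ := exists_smul_eq_fieldClass fun i => (B i : Fin n → OnShellField U M)
  -- Scaling a basis by its common denominator keeps it a basis and makes its elements classes of
  -- analytic fields.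
  let B' := B.isUnitSMul (w := fun _ => toFrac U M b) fun _ => hb
  have hB' : ∀ i, (B' i : Fin n → OnShellField U M) = fieldClass U M (Z i) (hZ i) := fun i => by
    rw [← hw i, Module.Basis.isUnitSMul_apply]
    rfl
  have hfun : (fun α => fieldClass U M (Z α) (hZ α)) = fun i => P.subtype (B' i) :=
    funext fun i => (hB' i).symm
  refine ⟨_, Z, hZ, ?_, ?_⟩
  · rw [hfun]
    exact B'.linearIndependent.map' P.subtype (Submodule.ker_subtype P)
  · rw [spanFields_eq_span_range hZ, hfun, Set.range_comp' P.subtype B', ← Submodule.map_span,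
      B'.span_eq, Submodule.map_top, Submodule.range_subtype]

/-- Common denominators for the expansions of finitely many fields of a distribution in a basis and
for the dual basis. -/
theorem exists_structure_functions [IsDomain (OnShellRing U M)] {r : ℕ}
    {Z : Fin r → PhaseSpace n → PhaseSpace n} (hZ : ∀ α, AnalyticOnNhd ℝ (Z α) U)
    (hli : LinearIndependent (OnShellField U M) (fun α => fieldClass U M (Z α) (hZ α)))
    {ι : Type*} [Finite ι] (Y : ι → PhaseSpace n → PhaseSpace n)
    (hY : ∀ i, MemDist (spanFields U M Z) (Y i)) :
    ∃ (b : PhaseSpace n → ℝ) (c : ι → Fin r → PhaseSpace n → ℝ)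
      (W : Fin n → Fin r → PhaseSpace n → ℝ),
      AnalyticOnNhd ℝ b U ∧ (∀ i β, AnalyticOnNhd ℝ (c i β) U) ∧
      (∀ i β, AnalyticOnNhd ℝ (W i β) U) ∧ (∃ x ∈ M, b x ≠ 0) ∧
      (∀ x ∈ M, ∀ i, b x • Y i x = ∑ β, c i β x • Z β x) ∧
      ∀ x ∈ M, ∀ α β, ∑ i, Z α x i * W i β x = if α = β then b x else 0 := by
  have hc : ∀ i, ∃ c : Fin r → OnShellField U M,
      ∑ α, c α • fieldClass U M (Z α) (hZ α) = fieldClass U M (Y i) (hY i).1 := fun i => by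
    have h := (hY i).2
    rw [spanFields_eq_span_range hZ] at h
    exact (Submodule.mem_span_range_iff_exists_fun _).1 h
  choose c hc using hc
  -- A left inverse of the expansion map plays the role of a dual basis; its matrix, with
  -- denominators cleared, will be `W`. It later extracts coefficients analytically and gives
  -- pointwise independence.
  obtain ⟨g, hg⟩ := LinearMap.exists_leftInverse_of_injective
    (Fintype.linearCombination (OnShellField U M) fun α => fieldClass U M (Z α) (hZ α))
    (LinearMap.ker_eq_bot.2 hli.fintypeLinearCombination_injective)
  have hgZ : ∀ α β, ∑ i, fieldClass U M (Z α) (hZ α) i * g (Pi.single i 1) β =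
      if α = β then 1 else 0 := by
    intro α β
    have h1 := congrFun (LinearMap.congr_fun hg (Pi.single α 1)) β
    simp only [LinearMap.comp_apply, Fintype.linearCombination_apply_single, one_smul,
      LinearMap.id_apply] at h1
    rw [LinearMap.pi_apply_eq_sum_univ g, Finset.sum_apply] at h1
    have hsing : ∀ i : Fin n, (fun j => if i = j then (1 : OnShellField U M) else 0) =
        Pi.single i 1 := fun i => funext fun j => by simp [Pi.single_apply, eq_comm]
    simp only [hsing, Pi.smul_apply, smul_eq_mul] at h1
    rw [h1, Pi.single_apply]
    simp only [eq_comm]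
  obtain ⟨b, a, hb, ha⟩ := exists_common_denominator
    (Sum.elim (fun p : ι × Fin r => c p.1 p.2) fun p : Fin n × Fin r => g (Pi.single p.1 1) p.2)
  refine ⟨b, fun i β => a (Sum.inl (i, β)), fun i β => a (Sum.inr (i, β)), b.2, fun i β => (a _).2,
    fun i β => (a _).2, ?_, ?_, ?_⟩
  · by_contra! h
    exact hb.ne_zero (toFrac_eq_zero.2 h)
  · intro x hx i
    have h : Set.EqOn (fun x => (b : PhaseSpace n → ℝ) x • Y i x)
        (fun x => ∑ β, (a (Sum.inl (i, β)) : PhaseSpace n → ℝ) x • Z β x) M := by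
      rw [← fieldClass_eq_iff (U := U) (b.2.smul (hY i).1)
        (AnalyticOnNhd.sum_smul (fun β => (a (Sum.inl (i, β))).2) hZ),
        fieldClass_smul b.2 (hY i).1, fieldClass_sum_smul (fun β => (a (Sum.inl (i, β))).2) hZ,
        ← hc i, Finset.smul_sum]
      refine Finset.sum_congr rfl fun β _ => ?_
      rw [smul_smul]
      exact congrArg (· • _) (ha (Sum.inl (i, β)))
    exact h hx
  · intro x hx α β
    have h : toFrac U M (∑ i, ⟨_, (hZ α).component i⟩ * a (Sum.inr (i, β))) =
        toFrac U M (if α = β then b else 0) := by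
      have h1 := congrArg (toFrac U M b * ·) (hgZ α β)
      simp only [Finset.mul_sum] at h1
      rw [map_sum]
      trans toFrac U M b * if α = β then 1 else 0
      · rw [← h1]
        refine Finset.sum_congr rfl fun i _ => ?_
        rw [map_mul, ← ha (Sum.inr (i, β)), fieldClass_apply, Sum.elim_inr]
        ring
      · split_ifs <;> simp
    have h2 := toFrac_eq_iff.1 h hx
    have h3 : ((∑ i, ⟨_, (hZ α).component i⟩ * a (Sum.inr (i, β)) : analyticRing U) :
        PhaseSpace n → ℝ) x = ∑ i, Z α x i * (a (Sum.inr (i, β)) : PhaseSpace n → ℝ) x := by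
      simp [Finset.sum_apply]
    rw [← h3, h2]
    split_ifs <;> rfl

end Basis

/-! ### Complete normal forms: tangency, observables, continuation of the algorithm. -/

namespace LocalSystem

open Filter Topology

variable {n : ℕ} {C : LocalSystem n}

/-- On a connected regular constraint surface the on-shell functions form a domain. -/
theorem isDomain_onShellRing (hC : IsConnected C.surface) :
    IsDomain (OnShellRing C.U C.surface) := by
  have hprime : (trivialIdeal C.U C.surface).IsPrime := by
    refine ⟨?_, ?_⟩
    · obtain ⟨x, hx⟩ := hC.nonempty
      rw [Ideal.ne_top_iff_one]
      exact fun h => one_ne_zero (h x hx : (1 : ℝ) = 0)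
    · intro f g hfg
      by_contra! h
      obtain ⟨hf, hg⟩ := h
      have hf' : ∃ x ∈ C.surface, (f : PhaseSpace n → ℝ) x ≠ 0 := by
        by_contra! h
        exact hf h
      obtain ⟨x, hx, hfx⟩ := hf'
      have hcont := (f.2 x (C.surface_subset_U hx)).continuousAt
      refine hg (C.eqOn_zero_of_eventually hC.isPreconnected g.2 hx ?_)
      filter_upwards [hcont.eventually_ne hfx] with y hy hyS
      exact (mul_eq_zero.1 (hfg y hyS : (f : PhaseSpace n → ℝ) y * (g : PhaseSpace n → ℝ) y = 0))
        |>.resolve_left hy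
  exact Ideal.Quotient.isDomain (trivialIdeal C.U C.surface)

/-- A point outside the closure would have a surface neighbourhood on which `b` vanishes, and unique
continuation would make `b` trivial. -/
theorem subset_closure_ne_zero (hC : IsPreconnected C.surface) {b : PhaseSpace n → ℝ}
    (hb : AnalyticOnNhd ℝ b C.U) (hb0 : ∃ x ∈ C.surface, b x ≠ 0) :
    C.surface ⊆ closure {x | x ∈ C.surface ∧ b x ≠ 0} := by
  intro x hx
  by_contra h
  obtain ⟨y, hy, hby⟩ := hb0
  refine hby (C.eqOn_zero_of_eventually hC hb hx ?_ y hy)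
  filter_upwards [isClosed_closure.isOpen_compl.mem_nhds h] with z hz hzS
  by_contra hbz
  exact hz (subset_closure ⟨hzS, hbz⟩)

/-- Distributions of fields tangent to the surface. -/
theorem exists_tangent_distribution (hC : IsConnected C.surface) :
    ∃ P : VFDistribution C.U C.surface, ∀ X, MemDist P X ↔ AnalyticOnNhd ℝ X C.U ∧
      ∀ a, ∀ x ∈ C.surface, alongField X (C.T a) x = 0 := by
  have := isDomain_onShellRing hC
  refine exists_distribution _ (fun a x _ => map_zero _) (fun X Y _ _ hX hY a x hx => ?_)
    (fun f X _ _ hX a x hx => ?_) (fun X Y _ _ h hX a x hx => ?_) fun f X hf hfu hXa hX a => ?_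
  · have h1 := hX a x hx
    have h2 := hY a x hx
    simp only [alongField, Pi.add_apply, map_add] at *
    rw [h1, h2, add_zero]
  · have h1 := hX a x hx
    simp only [alongField, map_smul] at *
    rw [h1, smul_zero]
  · rw [← hX a x hx, alongField, alongField, h hx]
  · have h1 : toFrac C.U C.surface (⟨f, hf⟩ * ⟨_, hXa.alongField (C.analytic_T a)⟩) = 0 := by
      refine toFrac_eq_zero.2 fun x hx => ?_
      have := hX a x hx
      rwa [alongField, map_smul] at this
    rw [map_mul, hfu.mul_right_eq_zero] at h1
    exact toFrac_eq_zero.1 h1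

section Complete

variable (hcomp : C.IsComplete) (hC : IsConnected C.surface)
include hcomp

theorem IsComplete.preservesTrivial_V : PreservesTrivial C.U C.surface C.V :=
  C.preservesTrivial_of_tangent hcomp.2.1

include hC

/-- Tangent fields form an involutive distribution containing all iterated commutators of the drift
with the characteristic fields, hence the gauge distribution. -/
theorem IsComplete.gauge_tangent {X : PhaseSpace n → PhaseSpace n} (hX : MemDist C.gauge X)
    (a : Fin C.m) : ∀ x ∈ C.surface, alongField X (C.T a) x = 0 := by
  obtain ⟨P, hP⟩ := exists_tangent_distribution hC
  have hbr : ∀ X Y, AnalyticOnNhd ℝ X C.U → AnalyticOnNhd ℝ Y C.U →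
      (∀ a, ∀ x ∈ C.surface, alongField X (C.T a) x = 0) →
      (∀ a, ∀ x ∈ C.surface, alongField Y (C.T a) x = 0) →
      ∀ a, ∀ x ∈ C.surface, alongField (VectorField.lieBracket ℝ X Y) (C.T a) x = 0 := by
    intro X Y hXa hYa hX hY a x hx
    rw [alongField_lieBracket hXa hYa (C.analytic_T a) (C.surface_subset_U hx),
      C.preservesTrivial_of_tangent hX _ (hYa.alongField (C.analytic_T a)) (hY a) x hx,
      C.preservesTrivial_of_tangent hY _ (hXa.alongField (C.analytic_T a)) (hX a) x hx, sub_zero]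
  have hle : C.gauge ≤ P := by
    refine gaugeDistribution_le (fun X Y _ _ hX hY => ?_) fun j α => ?_
    · rw [hP] at hX hY ⊢
      exact ⟨hX.1.lieBracket hY.1, hbr X Y hX.1 hY.1 hX.2 hY.2⟩
    · rw [hP]
      refine ⟨C.analytic_V.iterate_lieBracket (C.analytic_Z α) j, ?_⟩
      induction j with
      | zero => exact hcomp.2.2 α
      | succ j ih =>
        rw [Function.iterate_succ_apply']
        exact hbr _ _ C.analytic_V (C.analytic_V.iterate_lieBracket (C.analytic_Z α) j)
          hcomp.2.1 ih
  exact ((hP X).1 (hX.mono hle)).2 a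

theorem IsComplete.preservesTrivial_gauge {X : PhaseSpace n → PhaseSpace n}
    (hX : MemDist C.gauge X) : PreservesTrivial C.U C.surface X :=
  C.preservesTrivial_of_tangent (hcomp.gauge_tangent hC hX)

/-- The definition provides one invariant representative of the class. Every other differs from it
by a trivial function, which tangent gauge fields annihilate on the surface. -/
theorem IsComplete.observable_apply {O : PhaseSpace n → ℝ} (hO : RepresentsObservable C.gauge O)
    {X : PhaseSpace n → PhaseSpace n} (hX : MemDist C.gauge X) :
    ∀ x ∈ C.surface, alongField X O x = 0 := by
  obtain ⟨hOa, O', hO', h⟩ := hO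
  intro x hx
  have hxU := C.surface_subset_U hx
  have heq : Set.EqOn (O' : PhaseSpace n → ℝ) O C.surface :=
    toFrac_eq_iff.1 (congrArg (algebraMap _ (OnShellField C.U C.surface)) hO')
  have h1 := hcomp.preservesTrivial_gauge hC hX (fun x => O x - (O' : PhaseSpace n → ℝ) x)
    (hOa.sub O'.2) (fun y hy => by rw [heq hy, sub_self]) x hx
  have h2 : HasFDerivAt (fun x => O x - (O' : PhaseSpace n → ℝ) x)
      (fderiv ℝ O x - fderiv ℝ (O' : PhaseSpace n → ℝ) x) x :=
    (hOa x hxU).differentiableAt.hasFDerivAt.sub (O'.2 x hxU).differentiableAt.hasFDerivAt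
  rw [alongField, h2.fderiv] at h1
  have h3 := h X hX x hx
  simp only [alongField, sub_apply] at *
  rw [h3, sub_zero] at h1
  exact h1

theorem IsComplete.representsObservable_iff {O : PhaseSpace n → ℝ} :
    RepresentsObservable C.gauge O ↔ AnalyticOnNhd ℝ O C.U ∧
      ∀ X, MemDist C.gauge X → ∀ x ∈ C.surface, alongField X O x = 0 :=
  ⟨fun h => ⟨h.1, fun _ hX => hcomp.observable_apply hC h hX⟩,
    fun h => ⟨h.1, ⟨O, h.1⟩, rfl, h.2⟩⟩

/-- The drift derivative of an observable is an observable. -/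
theorem IsComplete.representsObservable_drift {O : PhaseSpace n → ℝ}
    (hO : RepresentsObservable C.gauge O) : RepresentsObservable C.gauge (alongField C.V O) := by
  rw [hcomp.representsObservable_iff hC] at hO ⊢
  refine ⟨C.analytic_V.alongField hO.1, fun X hX x hx => ?_⟩
  -- On the surface `X (V O) = V (X O) - [V, X] O`: the first term vanishes as `X O` is trivial, the
  -- second as `[V, X]` is a gauge field.
  have h1 := hO.2 _ (MemDist.lieBracket_drift C.analytic_V C.analytic_Z C.surface_subset_U
    hcomp.preservesTrivial_V hX) x hx
  rw [alongField_lieBracket C.analytic_V hX.1 hO.1 (C.surface_subset_U hx),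
    hcomp.preservesTrivial_V _ (hX.1.alongField hO.1) (hO.2 X hX) x hx, zero_sub,
    neg_eq_zero] at h1
  exact h1

end Complete

/-- A function annihilated by the characteristic fields evolves along the drift. -/
theorem IsSolution.hasDerivAt_comp {I : Set ℝ} {x : ℝ → PhaseSpace n} {lam : ℝ → Fin C.l → ℝ}
    (hsol : C.IsSolution I x lam) {O : PhaseSpace n → ℝ} (hO : AnalyticOnNhd ℝ O C.U)
    (hZ : ∀ α, ∀ x ∈ C.surface, alongField (C.Z α) O x = 0) {t : ℝ} (ht : t ∈ I) :
    HasDerivAt (fun s => O (x s)) (alongField C.V O (x t)) t := by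
  obtain ⟨hx, hder⟩ := hsol t ht
  have h := ((hO (x t) (C.surface_subset_U hx)).differentiableAt.hasFDerivAt).comp_hasDerivAt t hder
  have hZ' : ∀ α, fderiv ℝ O (x t) (C.Z α (x t)) = 0 := fun α => hZ α _ hx
  simp only [map_add, map_sum, map_smul, hZ', smul_zero, Finset.sum_const_zero, add_zero] at h
  exact h

/-- The restriction of a system to the regular part of its domain. -/
abbrev restrictRegular (C : LocalSystem n) : LocalSystem n where
  U := C.regularDomain
  isOpen_U := C.isOpen_regularDomain
  l := C.l
  m := C.m
  V := C.V
  Z := C.Z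
  T := C.T
  analytic_V := C.analytic_V.mono fun _ hx => hx.1
  analytic_Z α := (C.analytic_Z α).mono fun _ hx => hx.1
  analytic_T a := (C.analytic_T a).mono fun _ hx => hx.1

theorem regularDomain_restrictRegular : C.restrictRegular.regularDomain = C.regularDomain := by
  ext x
  exact ⟨fun h => h.1, fun h => ⟨h, fun y hy => h.2 y hy.1⟩⟩

theorem surface_restrictRegular : C.restrictRegular.surface = C.surface := by
  ext x
  exact and_congr (by rw [regularDomain_restrictRegular]) Iff.rfl

theorem IsComplete.restrictRegular (hC : C.IsComplete) : C.restrictRegular.IsComplete := by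
  rw [IsComplete, surface_restrictRegular]
  exact hC

/-- From a complete system the algorithm goes on without changing anything. -/
theorem IsComplete.isStage (hC : C.IsComplete) : IsStage C C.restrictRegular := by
  -- The minor is empty, with determinant `1`, so the stage only replaces the domain by its regular
  -- part.
  refine ⟨0, Equiv.emptySum (Fin 0) (Fin C.l), ⟨fun i => i.elim0, fun i => i.elim0⟩,
    fun _ => Matrix.of fun i => i.elim0, fun x => Subsingleton.elim _ _, fun x hx => ?_, ?_, ?_,
    fun x _ => by simp, fun α x _ => by simp, fun x hx => ?_, ?_⟩
  · have : C.conservationMatrix x = 0 := by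
      ext α a
      exact hC.2.2 α a x hx
    rw [this, Matrix.rank_zero]
  · obtain ⟨x, hx⟩ := hC.1
    exact ⟨x, hx, by simp⟩
  · ext x
    simp
  · exact ⟨fun h a => ⟨h a, hC.2.1 a x ⟨hx, h⟩⟩, fun h a => (h a).1⟩
  · rw [surface_restrictRegular]
    exact hC.1

theorem IsComplete.isRegular (hC : C.IsComplete) (hconn : IsConnected C.surface) :
    C.IsRegular := by
  let run : ℕ → LocalSystem n := fun k => LocalSystem.restrictRegular^[k] C
  have h : ∀ k, (run k).IsComplete ∧ (run k).surface = C.surface := by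
    intro k
    induction k with
    | zero => exact ⟨hC, rfl⟩
    | succ k ih =>
      simp only [run, Function.iterate_succ_apply'] at ih ⊢
      exact ⟨ih.1.restrictRegular, surface_restrictRegular.trans ih.2⟩
  refine ⟨run, rfl, fun k => ?_, fun k => (h k).2 ▸ hconn⟩
  simp only [run, Function.iterate_succ_apply']
  exact (h k).1.isStage

end LocalSystem

/-! ### Smoothness of jets and test parameters. -/

section TimeDerivatives

theorem ContDiffOn.iteratedDeriv_of_isOpen {F : Type*} [NormedAddCommGroup F] [NormedSpace ℝ F]
    {f : ℝ → F} {I : Set ℝ} (hf : ContDiffOn ℝ ∞ f I) (hI : IsOpen I) (j : ℕ) :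
    ContDiffOn ℝ ∞ (iteratedDeriv j f) I := by
  induction j with
  | zero => simpa using hf
  | succ j ih =>
    rw [iteratedDeriv_succ]
    exact ih.deriv_of_isOpen hI (by simp)

theorem ContDiffOn.hasDerivAt_iteratedDeriv {f : ℝ → ℝ} {I : Set ℝ} (hf : ContDiffOn ℝ ∞ f I)
    (hI : IsOpen I) (j : ℕ) {t : ℝ} (ht : t ∈ I) :
    HasDerivAt (iteratedDeriv j f) (iteratedDeriv (j + 1) f t) t := by
  rw [iteratedDeriv_succ]
  exact (((hf.iteratedDeriv_of_isOpen hI j).differentiableOn (by simp)).differentiableAt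
    (hI.mem_nhds ht)).hasDerivAt

/-- A smooth function with a single nonzero Taylor coefficient at `t`. -/
theorem exists_smooth_iteratedDeriv_eq (m : ℕ) (t : ℝ) :
    ∃ e : ℝ → ℝ, ContDiff ℝ ∞ e ∧ ∀ j, iteratedDeriv j e t = if j = m then 1 else 0 := by
  refine ⟨fun s => (m.factorial : ℝ)⁻¹ * (s - t) ^ m, by fun_prop, fun j => ?_⟩
  rw [iteratedDeriv_const_mul_field, iteratedDeriv_comp_sub_const (f := fun s : ℝ => s ^ m)]
  simp only [sub_self]
  rw [iteratedDeriv_fun_pow_zero]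
  split_ifs with h1
  · simp [Nat.factorial_ne_zero]
  · simp

theorem contDiffOn_jetAt {n l : ℕ} (k : ℕ) {I : Set ℝ} (hI : IsOpen I)
    {x : ℝ → PhaseSpace n} {lam : ℝ → Fin l → ℝ} (hx : ContDiffOn ℝ ∞ x I)
    (hlam : ContDiffOn ℝ ∞ lam I) : ContDiffOn ℝ ∞ (jetAt k x lam) I := by
  refine hx.prodMk (contDiffOn_pi.2 fun j => contDiffOn_pi.2 fun α => ?_)
  exact (contDiffOn_pi.1 hlam α).iteratedDeriv_of_isOpen hI j

end TimeDerivatives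

/-! ### The simple form is a gauge symmetry. -/

namespace InfTransformation

open Filter Topology

variable {n : ℕ} {S : LocalSystem n} {b : PhaseSpace n → ℝ}
  {v : Fin S.l → Fin S.l → PhaseSpace n → ℝ} {u : Fin S.l → Fin S.l → Fin S.l → PhaseSpace n → ℝ}

theorem deltaX_simpleForm (x : ℝ → PhaseSpace n) (lam : ℝ → Fin S.l → ℝ) (ε : ℝ → Fin S.l → ℝ)
    (t : ℝ) : (simpleForm S.U S.Z b v u).deltaX x lam ε t = ∑ β, ε t β • S.Z β (x t) := by
  show ∑ j ∈ Finset.range 1, ∑ A : Fin S.l, iteratedDeriv j (fun s => ε s A) t • S.Z A (x t) = _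
  simp

theorem deltaLam_simpleForm (x : ℝ → PhaseSpace n) (lam : ℝ → Fin S.l → ℝ) (ε : ℝ → Fin S.l → ℝ)
    (t : ℝ) (α : Fin S.l) : (simpleForm S.U S.Z b v u).deltaLam x lam ε t α =
      deriv (fun s => ε s α) t - ∑ β, ε t β *
        (v β α (x t) / b (x t) + ∑ γ, u β γ α (x t) / b (x t) * lam t γ) := by
  show (∑ j ∈ Finset.range 2, ∑ A : Fin S.l, iteratedDeriv j (fun s => ε s A) t •
    (fun α : Fin S.l => if j = 0 then -(v A α (x t) / b (x t) +
      ∑ γ, u A γ α (x t) / b (x t) * iteratedDeriv 0 (fun s => lam s γ) t)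
        else if α = A then (1 : ℝ) else 0)) α = _
  simp only [Finset.sum_range_succ, Finset.sum_range_zero, zero_add, iteratedDeriv_zero,
    iteratedDeriv_one, if_true, one_ne_zero, if_false, Finset.sum_apply,
    Pi.smul_apply, smul_eq_mul, mul_neg, Finset.sum_neg_distrib, mul_ite, mul_one, mul_zero,
    Finset.sum_ite_eq]
  rw [if_pos (Finset.mem_univ α), neg_add_eq_sub]

/-- Derivative of the characteristic fields along the trajectories, by the commutation
relations. -/
theorem fderiv_characteristic_velocity
    (hV : ∀ x ∈ S.surface, ∀ α,
      b x • VectorField.lieBracket ℝ (S.Z α) S.V x = ∑ β, v α β x • S.Z β x)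
    (hZ : ∀ x ∈ S.surface, ∀ α β,
      b x • VectorField.lieBracket ℝ (S.Z α) (S.Z β) x = ∑ γ, u α β γ x • S.Z γ x)
    {x : PhaseSpace n} (hx : x ∈ S.surface) (hb : b x ≠ 0) (lam : Fin S.l → ℝ) (β : Fin S.l) :
    fderiv ℝ (S.Z β) x (S.V x + ∑ γ, lam γ • S.Z γ x) =
      fderiv ℝ S.V x (S.Z β x) + ∑ γ, lam γ • fderiv ℝ (S.Z γ) x (S.Z β x) -
        ∑ α, (v β α x / b x + ∑ γ, u β γ α x / b x * lam γ) • S.Z α x := by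
  have h1 : fderiv ℝ S.V x (S.Z β x) - fderiv ℝ (S.Z β) x (S.V x) =
      ∑ α, (v β α x / b x) • S.Z α x := by
    have h := congrArg ((b x)⁻¹ • ·) (hV x hx β)
    simp only [inv_smul_smul₀ hb, Finset.smul_sum, smul_smul] at h
    exact h.trans (Finset.sum_congr rfl fun α _ => by rw [div_eq_inv_mul])
  have h2 : ∀ γ, fderiv ℝ (S.Z γ) x (S.Z β x) - fderiv ℝ (S.Z β) x (S.Z γ x) =
      ∑ α, (u β γ α x / b x) • S.Z α x := fun γ => by
    have h := congrArg ((b x)⁻¹ • ·) (hZ x hx β γ)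
    simp only [inv_smul_smul₀ hb, Finset.smul_sum, smul_smul] at h
    exact h.trans (Finset.sum_congr rfl fun α _ => by rw [div_eq_inv_mul])
  have h3 : ∑ α, (v β α x / b x + ∑ γ, u β γ α x / b x * lam γ) • S.Z α x =
      (fderiv ℝ S.V x (S.Z β x) - fderiv ℝ (S.Z β) x (S.V x)) +
        ∑ γ, lam γ • (fderiv ℝ (S.Z γ) x (S.Z β x) - fderiv ℝ (S.Z β) x (S.Z γ x)) := by
    simp only [h1, h2, add_smul, Finset.sum_add_distrib, Finset.sum_smul, Finset.smul_sum,
      smul_smul]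
    rw [Finset.sum_comm]
    simp only [mul_comm]
  rw [h3]
  simp only [map_add, map_sum, map_smul, smul_sub, Finset.sum_sub_distrib]
  abel

/-- The commutation relations turn the time derivative of `Z_β` into the linearized velocity applied
to `Z_β` plus a combination of characteristic fields; `δλ` is exactly what absorbs this combination
and the term with `ε̇`. -/
theorem isInvariantVariation_characteristic
    (htan : ∀ α a, ∀ x ∈ S.surface, alongField (S.Z α) (S.T a) x = 0)
    (hV : ∀ x ∈ S.surface, ∀ α,
      b x • VectorField.lieBracket ℝ (S.Z α) S.V x = ∑ β, v α β x • S.Z β x)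
    (hZ : ∀ x ∈ S.surface, ∀ α β,
      b x • VectorField.lieBracket ℝ (S.Z α) (S.Z β) x = ∑ γ, u α β γ x • S.Z γ x)
    {I : Set ℝ} {x : ℝ → PhaseSpace n} {lam : ℝ → Fin S.l → ℝ} (hsol : S.IsSolution I x lam)
    (hb : ∀ t ∈ I, b (x t) ≠ 0) {ε : ℝ → Fin S.l → ℝ}
    (hε : ∀ t ∈ I, ∀ β, DifferentiableAt ℝ (fun s => ε s β) t) :
    S.IsInvariantVariation I x lam (fun t => ∑ β, ε t β • S.Z β (x t))
      (fun t α => deriv (fun s => ε s α) t - ∑ β, ε t β *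
        (v β α (x t) / b (x t) + ∑ γ, u β γ α (x t) / b (x t) * lam t γ)) := by
  intro t ht
  obtain ⟨hxS, hder⟩ := hsol t ht
  constructor
  · have h1 : HasDerivAt (fun t => ∑ β, ε t β • S.Z β (x t))
        (∑ β, (ε t β • fderiv ℝ (S.Z β) (x t) (S.V (x t) + ∑ α, lam t α • S.Z α (x t)) +
          deriv (fun s => ε s β) t • S.Z β (x t))) t :=
      HasDerivAt.fun_sum fun β _ => (hε t ht β).hasDerivAt.smul
        ((S.analytic_Z β _ (S.surface_subset_U hxS)).differentiableAt.hasFDerivAt.comp_hasDerivAt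
          t hder)
    convert h1 using 1
    simp only [fderiv_characteristic_velocity hV hZ hxS (hb t ht), map_sum,
      map_smul, smul_sub, smul_add, sub_smul, Finset.smul_sum, Finset.sum_smul,
      Finset.sum_add_distrib, Finset.sum_sub_distrib, smul_smul]
    rw [Finset.sum_comm (f := fun x_1 x_2 => (ε t x_2 * _) • S.Z x_1 (x t)),
      Finset.sum_comm (f := fun α β => (lam t α * ε t β) • _)]
    simp only [mul_comm (lam t _)]
    abel
  · intro a
    have h0 : ∀ β, fderiv ℝ (S.T a) (x t) (S.Z β (x t)) = 0 := fun β => htan β a _ hxS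
    simp only [map_sum, map_smul, h0, smul_zero, Finset.sum_const_zero]

theorem analyticAt_simpleForm_coefficient (hba : AnalyticOnNhd ℝ b S.U)
    (hva : ∀ α β, AnalyticOnNhd ℝ (v α β) S.U) (hua : ∀ α β γ, AnalyticOnNhd ℝ (u α β γ) S.U)
    (α β : Fin S.l) {w : JetSpace n S.l 0} (hw : w.1 ∈ S.U) (hb : b w.1 ≠ 0) :
    AnalyticAt ℝ (fun w : JetSpace n S.l 0 =>
      -(v β α w.1 / b w.1 + ∑ γ, u β γ α w.1 / b w.1 * w.2 0 γ)) w := by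
  have hfst : ∀ {f : PhaseSpace n → ℝ}, AnalyticOnNhd ℝ f S.U →
      AnalyticAt ℝ (fun w : JetSpace n S.l 0 => f w.1) w :=
    fun hf => (hf w.1 hw).comp analyticAt_fst
  have hproj : ∀ γ : Fin S.l, AnalyticAt ℝ (fun w : JetSpace n S.l 0 => w.2 0 γ) w := fun γ =>
    ((ContinuousLinearMap.proj (R := ℝ) (φ := fun _ : Fin S.l => ℝ) γ).comp
      ((ContinuousLinearMap.proj (R := ℝ) (φ := fun _ : Fin 1 => Fin S.l → ℝ) 0).comp
        (ContinuousLinearMap.snd ℝ (PhaseSpace n) (Fin 1 → Fin S.l → ℝ)))).analyticAt w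
  exact (((hfst (hva β α)).div (hfst hba) hb).add (Finset.univ.analyticAt_fun_sum fun γ _ =>
    ((hfst (hua β γ α)).div (hfst hba) hb).mul (hproj γ))).neg

theorem isGaugeSymmetry_simpleForm (hba : AnalyticOnNhd ℝ b S.U)
    (hva : ∀ α β, AnalyticOnNhd ℝ (v α β) S.U) (hua : ∀ α β γ, AnalyticOnNhd ℝ (u α β γ) S.U)
    (htan : ∀ α a, ∀ x ∈ S.surface, alongField (S.Z α) (S.T a) x = 0)
    (hV : ∀ x ∈ S.surface, ∀ α,
      b x • VectorField.lieBracket ℝ (S.Z α) S.V x = ∑ β, v α β x • S.Z β x)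
    (hZ : ∀ x ∈ S.surface, ∀ α β,
      b x • VectorField.lieBracket ℝ (S.Z α) (S.Z β) x = ∑ γ, u α β γ x • S.Z γ x) :
    IsGaugeSymmetry S (simpleForm S.U S.Z b v u) := by
  have hconst : ∀ (c : ℝ) (w : JetSpace n S.l 0), AnalyticAt ℝ (fun _ : JetSpace n S.l 0 => c) w :=
    fun _ _ => analyticAt_const
  refine ⟨?_, fun w hw => hw.1, fun j β w hw => ?_, fun j β w hw => ?_, ?_⟩
  · have h : IsOpen (S.U ∩ b ⁻¹' {0}ᶜ) :=
      hba.continuousOn.isOpen_inter_preimage S.isOpen_U isOpen_compl_singleton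
    exact h.preimage continuous_fst
  · exact (S.analytic_Z β w.1 hw.1).comp analyticAt_fst
  · refine AnalyticAt.pi fun α => ?_
    simp only [simpleForm]
    split_ifs
    · exact analyticAt_simpleForm_coefficient hba hva hua α β hw.1 hw.2
    · exact hconst 1 w
    · exact hconst 0 w
  · intro I x lam ε hI hx hlam hε hsol hdom
    have hX : (simpleForm S.U S.Z b v u).deltaX x lam ε =
        fun t => ∑ β, ε t β • S.Z β (x t) := funext fun t => deltaX_simpleForm x lam ε t
    have hL : (simpleForm S.U S.Z b v u).deltaLam x lam ε = fun t α =>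
        deriv (fun s => ε s α) t - ∑ β, ε t β *
          (v β α (x t) / b (x t) + ∑ γ, u β γ α (x t) / b (x t) * lam t γ) :=
      funext fun t => funext fun α => deltaLam_simpleForm x lam ε t α
    rw [hX, hL]
    exact isInvariantVariation_characteristic htan hV hZ hsol (fun t ht => (hdom t ht).2)
      fun t ht β => ((contDiffOn_pi.1 hε β).differentiableOn (by simp)).differentiableAt
        (hI.mem_nhds ht)

end InfTransformation

/-! ### Every gauge symmetry reduces to the simple form. -/

namespace InfTransformation

open Filter Topology

variable {n : ℕ} {S : LocalSystem n}

/-- Linearized right-hand side of the equations of motion along a solution. -/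
def linearizedVelocity (S : LocalSystem n) (x : PhaseSpace n) (lam : Fin S.l → ℝ) :
    PhaseSpace n →L[ℝ] PhaseSpace n :=
  fderiv ℝ S.V x + ∑ α, lam α • fderiv ℝ (S.Z α) x

theorem linearizedVelocity_apply (x : PhaseSpace n) (lam : Fin S.l → ℝ) (w : PhaseSpace n) :
    linearizedVelocity S x lam w =
      fderiv ℝ S.V x w + ∑ α, lam α • fderiv ℝ (S.Z α) x w := by
  simp [linearizedVelocity]

/-- Coefficient functions of a gauge symmetry along a trajectory, extended by zero. -/
def coeffX (G : InfTransformation n S.l) (x : ℝ → PhaseSpace n) (lam : ℝ → Fin S.l → ℝ)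
    (A : Fin G.params) (j : ℕ) (t : ℝ) : PhaseSpace n :=
  if j ≤ G.order then G.R j A (jetAt G.jetOrder x lam t) else 0

theorem contDiffOn_comp_jetAt {k : ℕ} {F : Type*} [NormedAddCommGroup F] [NormedSpace ℝ F]
    [CompleteSpace F] {f : JetSpace n S.l k → F} {D : Set (JetSpace n S.l k)}
    (hf : AnalyticOnNhd ℝ f D) {I : Set ℝ} (hI : IsOpen I)
    {x : ℝ → PhaseSpace n} {lam : ℝ → Fin S.l → ℝ} (hx : ContDiffOn ℝ ∞ x I)
    (hlam : ContDiffOn ℝ ∞ lam I) (hD : ∀ t ∈ I, jetAt k x lam t ∈ D) :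
    ContDiffOn ℝ ∞ (fun t => f (jetAt k x lam t)) I := fun t ht =>
  (((hf _ (hD t ht)).contDiffAt (n := ∞)).comp t
    ((contDiffOn_jetAt k hI hx hlam).contDiffAt (hI.mem_nhds ht))).contDiffWithinAt

/-- Comparison of the coefficients of `ε^(i + 1)` in the invariance condition. -/
theorem IsGaugeSymmetry.hasDerivAt_coeffX {G : InfTransformation n S.l}
    (hG : IsGaugeSymmetry S G) {I : Set ℝ} (hI : IsOpen I) {x : ℝ → PhaseSpace n}
    {lam : ℝ → Fin S.l → ℝ} (hx : ContDiffOn ℝ ∞ x I) (hlam : ContDiffOn ℝ ∞ lam I)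
    (hsol : S.IsSolution I x lam) (hD : ∀ t ∈ I, jetAt G.jetOrder x lam t ∈ G.domain)
    (A : Fin G.params) {i : ℕ} (hi : i ≤ G.order) {t : ℝ} (ht : t ∈ I) :
    HasDerivAt (coeffX G x lam A (i + 1))
      (linearizedVelocity S (x t) (lam t) (coeffX G x lam A (i + 1) t) +
        ∑ α, G.Q (i + 1) A (jetAt G.jetOrder x lam t) α • S.Z α (x t) - coeffX G x lam A i t) t := by
  obtain ⟨-, -, hR, -, hinv⟩ := hG
  have hsm : ∀ j, ContDiffOn ℝ ∞ (coeffX G x lam A j) I := fun j => by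
    unfold coeffX
    split_ifs
    · exact contDiffOn_comp_jetAt (hR j A) hI hx hlam hD
    · exact contDiffOn_const
  have hder : ∀ j, HasDerivAt (coeffX G x lam A j) (deriv (coeffX G x lam A j) t) t := fun j =>
    (((hsm j).differentiableOn (by simp)).differentiableAt (hI.mem_nhds ht)).hasDerivAt
  -- A parameter whose only nonzero derivative at `t` is the one of order `i + 1` isolates a single
  -- coefficient.
  obtain ⟨e, he, het⟩ := exists_smooth_iteratedDeriv_eq (i + 1) t
  let ε : ℝ → Fin G.params → ℝ := fun s => Pi.single A (e s)
  have hεA : ∀ B, B ≠ A → (fun s => ε s B) = fun _ => 0 := fun B hB =>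
    funext fun s => Pi.single_eq_of_ne hB _
  have hε : (fun s => ε s A) = e := funext fun s => Pi.single_eq_same _ _
  have hεs : ContDiff ℝ ∞ ε := contDiff_pi.2 fun B => by
    by_cases hB : B = A
    · rw [hB, hε]; exact he
    · rw [hεA B hB]; exact contDiff_const
  have hsum : ∀ {E : Type} [AddCommGroup E] [Module ℝ E] (f : ℕ → Fin G.params → E) (N : ℕ)
      (s : ℝ), ∑ j ∈ Finset.range N, ∑ B, iteratedDeriv j (fun s => ε s B) s • f j B =
        ∑ j ∈ Finset.range N, iteratedDeriv j e s • f j A := fun f N s => by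
    refine Finset.sum_congr rfl fun j _ => ?_
    rw [Finset.sum_eq_single A (fun B _ hB => ?_) (fun h => absurd (Finset.mem_univ A) h), hε]
    rw [hεA B hB, iteratedDeriv_const]
    simp
  have hX : G.deltaX x lam ε = fun s =>
      ∑ j ∈ Finset.range (G.order + 1), iteratedDeriv j e s • coeffX G x lam A j s := by
    funext s
    rw [deltaX, hsum (fun j B => G.R j B (jetAt G.jetOrder x lam s))]
    refine Finset.sum_congr rfl fun j hj => ?_
    rw [coeffX, if_pos (Nat.lt_succ_iff.1 (Finset.mem_range.1 hj))]
  have hXt : G.deltaX x lam ε t = coeffX G x lam A (i + 1) t := by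
    rw [hX]
    simp only [het, ite_smul, one_smul, zero_smul, Finset.sum_ite_eq', Finset.mem_range]
    by_cases h : i + 1 < G.order + 1
    · rw [if_pos h]
    · rw [if_neg h, coeffX, if_neg (by omega)]
  have hL : G.deltaLam x lam ε t = G.Q (i + 1) A (jetAt G.jetOrder x lam t) := by
    rw [deltaLam, hsum (fun j B => G.Q j B (jetAt G.jetOrder x lam t))]
    simp only [het, ite_smul, one_smul, zero_smul, Finset.sum_ite_eq', Finset.mem_range]
    rw [if_pos (by omega)]
  have h1 := (hinv I x lam ε hI hx hlam hεs.contDiffOn hsol hD t ht).1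
  -- By the product rule the derivative of `δx` at `t` is the derivative of the coefficient `i + 1`
  -- plus the coefficient `i`. For `i = G.order` the former is zero, in accordance with the
  -- extension by zero.
  have h2 : HasDerivAt (G.deltaX x lam ε) (∑ j ∈ Finset.range (G.order + 1),
      (iteratedDeriv j e t • deriv (coeffX G x lam A j) t +
        iteratedDeriv (j + 1) e t • coeffX G x lam A j t)) t := by
    rw [hX]
    exact HasDerivAt.fun_sum fun j _ =>
      (he.contDiffOn.hasDerivAt_iteratedDeriv isOpen_univ j (Set.mem_univ t)).smul (hder j)
  have h3 := h1.unique h2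
  simp only [het, ite_smul, one_smul, zero_smul, Finset.sum_add_distrib, Finset.sum_ite_eq',
    Finset.mem_range, add_left_inj] at h3
  rw [if_pos (show i < G.order + 1 by omega), hXt, hL] at h3
  have h4 : (if i + 1 < G.order + 1 then deriv (coeffX G x lam A (i + 1)) t else 0) =
      deriv (coeffX G x lam A (i + 1)) t := by
    split_ifs with h
    · rfl
    · have : coeffX G x lam A (i + 1) = fun _ => 0 := by
        funext s
        rw [coeffX, if_neg (by omega)]
      rw [this, deriv_const]
  rw [h4] at h3
  rw [linearizedVelocity_apply, h3, add_sub_cancel_right]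
  exact hder (i + 1)

section Reduction

variable {b : PhaseSpace n → ℝ}
  {v : Fin S.l → Fin S.l → PhaseSpace n → ℝ} {u : Fin S.l → Fin S.l → Fin S.l → PhaseSpace n → ℝ}
  {W : Fin n → Fin S.l → PhaseSpace n → ℝ}

/-- Coefficients with respect to the characteristic fields, given by the dual basis. -/
theorem dual_apply_sum
    (hdual : ∀ x ∈ S.surface, ∀ α β, ∑ i, S.Z α x i * W i β x = if α = β then b x else 0)
    {x : PhaseSpace n} (hx : x ∈ S.surface) (hb : b x ≠ 0) (c : Fin S.l → ℝ) (β : Fin S.l) :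
    (∑ i, (∑ α, c α • S.Z α x) i * W i β x) / b x = c β := by
  have h : ∑ i, (∑ α, c α • S.Z α x) i * W i β x = ∑ α, c α * ∑ i, S.Z α x i * W i β x := by
    simp only [Finset.sum_apply, Pi.smul_apply, smul_eq_mul, Finset.sum_mul, Finset.mul_sum]
    rw [Finset.sum_comm]
    simp only [mul_assoc]
  rw [h]
  simp only [hdual x hx, mul_ite, mul_zero, Finset.sum_ite_eq', Finset.mem_univ, if_true]
  field_simp

theorem linearIndependent_of_dual
    (hdual : ∀ x ∈ S.surface, ∀ α β, ∑ i, S.Z α x i * W i β x = if α = β then b x else 0)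
    {x : PhaseSpace n} (hx : x ∈ S.surface) (hb : b x ≠ 0) :
    LinearIndependent ℝ fun α => S.Z α x := by
  rw [Fintype.linearIndependent_iff]
  intro c hc β
  rw [← dual_apply_sum hdual hx hb c β, hc]
  simp

/-- The `x`-variation of a gauge symmetry is along the characteristic fields. -/
theorem IsGaugeSymmetry.coeffX_eq_sum {G : InfTransformation n S.l}
    (hG : IsGaugeSymmetry S G) (hba : AnalyticOnNhd ℝ b S.U)
    (hWa : ∀ i β, AnalyticOnNhd ℝ (W i β) S.U)
    (hdual : ∀ x ∈ S.surface, ∀ α β, ∑ i, S.Z α x i * W i β x = if α = β then b x else 0)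
    (hV : ∀ x ∈ S.surface, ∀ α,
      b x • VectorField.lieBracket ℝ (S.Z α) S.V x = ∑ β, v α β x • S.Z β x)
    (hZ : ∀ x ∈ S.surface, ∀ α β,
      b x • VectorField.lieBracket ℝ (S.Z α) (S.Z β) x = ∑ γ, u α β γ x • S.Z γ x)
    {I : Set ℝ} (hI : IsOpen I) {x : ℝ → PhaseSpace n}
    {lam : ℝ → Fin S.l → ℝ} (hx : ContDiffOn ℝ ∞ x I) (hlam : ContDiffOn ℝ ∞ lam I)
    (hsol : S.IsSolution I x lam)
    (hD : ∀ t ∈ I, jetAt G.jetOrder x lam t ∈ G.domain) (hb : ∀ t ∈ I, b (x t) ≠ 0)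
    (A : Fin G.params) (j : ℕ) : ∀ t ∈ I, coeffX G x lam A j t =
      ∑ β, ((∑ i, coeffX G x lam A j t i * W i β (x t)) / b (x t)) • S.Z β (x t) := by
  -- Descending induction on `j`, started above `G.order`, where the coefficient is zero.
  suffices h : ∀ d j, G.order < j + d → ∀ t ∈ I, coeffX G x lam A j t =
      ∑ β, ((∑ i, coeffX G x lam A j t i * W i β (x t)) / b (x t)) • S.Z β (x t) from
    h (G.order + 1) j (by omega)
  intro d
  induction d with
  | zero =>
    intro j hj t _
    have : coeffX G x lam A j t = 0 := by rw [coeffX, if_neg (by omega)]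
    simp [this]
  | succ d ih =>
    intro j hj
    by_cases hjo : G.order < j
    · exact ih j (by omega)
    have ih' := ih (j + 1) (by omega)
    intro t ht
    obtain ⟨hxS, hxd⟩ := hsol t ht
    have hE := hG.hasDerivAt_coeffX hI hx hlam hsol hD A (Nat.le_of_not_lt hjo) ht
    let q : Fin S.l → ℝ → ℝ := fun β t =>
      (∑ i, coeffX G x lam A (j + 1) t i * W i β (x t)) / b (x t)
    have hqd : ∀ β, DifferentiableAt ℝ (q β) t := fun β => by
      have hcomp : ∀ {f : PhaseSpace n → ℝ}, AnalyticOnNhd ℝ f S.U →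
          DifferentiableAt ℝ (fun t => f (x t)) t := fun hf =>
        (hf _ (S.surface_subset_U hxS)).differentiableAt.comp t hxd.differentiableAt
      exact (DifferentiableAt.fun_sum fun i _ =>
        (differentiableAt_pi.1 hE.differentiableAt i).mul (hcomp (hWa i β))).div (hcomp hba)
          (hb t ht)
    have hq : coeffX G x lam A (j + 1) =ᶠ[𝓝 t] fun t => ∑ β, q β t • S.Z β (x t) := by
      filter_upwards [hI.mem_nhds ht] with s hs
      exact ih' s hs
    have h1 : HasDerivAt (fun t => ∑ β, q β t • S.Z β (x t))
        (∑ β, (q β t • fderiv ℝ (S.Z β) (x t) (S.V (x t) + ∑ α, lam t α • S.Z α (x t)) +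
          deriv (q β) t • S.Z β (x t))) t :=
      HasDerivAt.fun_sum fun β _ => (hqd β).hasDerivAt.smul
        ((S.analytic_Z β _ (S.surface_subset_U hxS)).differentiableAt.hasFDerivAt.comp_hasDerivAt
          t hxd)
    have h2 := hE.unique (h1.congr_of_eventuallyEq hq)
    -- With `∑ q_β Z_β` inserted for the next coefficient, the linearized velocity terms cancel by
    -- the commutation relations and only multiples of the `Z_β` remain.
    have h3 : coeffX G x lam A j t = ∑ β, (G.Q (j + 1) A (jetAt G.jetOrder x lam t) β
        + ∑ γ, q γ t * (v γ β (x t) / b (x t) + ∑ δ, u γ δ β (x t) / b (x t) * lam t δ)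
        - deriv (q β) t) • S.Z β (x t) := by
      have h4 : ∀ β, fderiv ℝ (S.Z β) (x t) (S.V (x t) + ∑ α, lam t α • S.Z α (x t)) =
          linearizedVelocity S (x t) (lam t) (S.Z β (x t)) - ∑ α, (v β α (x t) / b (x t) +
            ∑ γ, u β γ α (x t) / b (x t) * lam t γ) • S.Z α (x t) := fun β => by
        rw [linearizedVelocity_apply]
        exact fderiv_characteristic_velocity hV hZ hxS (hb t ht) (lam t) β
      rw [sub_eq_iff_eq_add, ← sub_eq_iff_eq_add'] at h2
      rw [← h2, hq.self_of_nhds]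
      simp only [h4, map_sum, map_smul, smul_sub, sub_smul, add_smul (G.Q _ _ _ _),
        Finset.smul_sum, Finset.sum_smul, Finset.sum_add_distrib, Finset.sum_sub_distrib, smul_smul]
      rw [Finset.sum_comm (f := fun β γ => (q γ t * _) • S.Z β (x t))]
      abel
    rw [h3]
    refine Finset.sum_congr rfl fun β _ => ?_
    rw [dual_apply_sum hdual hxS (hb t ht)]

/-- The dual basis reads off `η` from `δx = ∑ η^β Z_β`. Then `δλ` and the variation of the simple
form solve the same linearized equation with the same `δx`, and independence of the `Z_β` makes them
equal. -/
theorem IsGaugeSymmetry.reducesTo_simpleForm {G : InfTransformation n S.l}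
    (hG : IsGaugeSymmetry S G) (hba : AnalyticOnNhd ℝ b S.U)
    (hWa : ∀ i β, AnalyticOnNhd ℝ (W i β) S.U)
    (hdual : ∀ x ∈ S.surface, ∀ α β, ∑ i, S.Z α x i * W i β x = if α = β then b x else 0)
    (htan : ∀ α a, ∀ x ∈ S.surface, alongField (S.Z α) (S.T a) x = 0)
    (hV : ∀ x ∈ S.surface, ∀ α,
      b x • VectorField.lieBracket ℝ (S.Z α) S.V x = ∑ β, v α β x • S.Z β x)
    (hZ : ∀ x ∈ S.surface, ∀ α β,
      b x • VectorField.lieBracket ℝ (S.Z α) (S.Z β) x = ∑ γ, u α β γ x • S.Z γ x) :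
    ReducesTo S b G (simpleForm S.U S.Z b v u) := by
  have hHa : ∀ j A, AnalyticOnNhd ℝ (fun (w : JetSpace n S.l G.jetOrder) (β : Fin S.l) =>
      (∑ i, G.R j A w i * W i β w.1) / b w.1) {w | w ∈ G.domain ∧ b w.1 ≠ 0} := by
    intro j A w hw
    refine AnalyticAt.pi fun β => ?_
    have hwU := hG.2.1 w hw.1
    exact (Finset.univ.analyticAt_fun_sum fun i _ =>
      (analyticAt_pi_iff.1 (hG.2.2.1 j A w hw.1) i).mul
        ((hWa i β w.1 hwU).comp analyticAt_fst)).div ((hba w.1 hwU).comp analyticAt_fst) hw.2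
  refine ⟨fun j A w β => (∑ i, G.R j A w i * W i β w.1) / b w.1, hHa, ?_⟩
  intro I x lam ε η hI hx hlam hε hsol hD hη
  have hD1 : ∀ t ∈ I, jetAt G.jetOrder x lam t ∈ G.domain := fun t ht => (hD t ht).1
  have hb : ∀ t ∈ I, b (x t) ≠ 0 := fun t ht => (hD t ht).2
  let η' : ℝ → Fin S.l → ℝ := η
  have hη' : ∀ t ∈ I, ∀ β, η' t β = ∑ j ∈ Finset.range (G.order + 1), ∑ A,
      iteratedDeriv j (fun s => ε s A) t *
        ((∑ i, G.R j A (jetAt G.jetOrder x lam t) i * W i β (x t)) / b (x t)) := by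
    intro t ht β
    have h0 : η' t = ∑ j ∈ Finset.range (G.order + 1), ∑ A,
        iteratedDeriv j (fun s => ε s A) t • (fun β : Fin S.l =>
          (∑ i, G.R j A (jetAt G.jetOrder x lam t) i * W i β (x t)) / b (x t)) := hη t ht
    have h := congrFun h0 β
    rw [Finset.sum_apply] at h
    refine h.trans (Finset.sum_congr rfl fun j _ => ?_)
    rw [Finset.sum_apply]
    rfl
  have hηs : ContDiffOn ℝ ∞ η' I := by
    have h : ContDiffOn ℝ ∞ (fun t => ∑ j ∈ Finset.range (G.order + 1), ∑ A,
        iteratedDeriv j (fun s => ε s A) t • (fun β : Fin S.l =>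
          (∑ i, G.R j A (jetAt G.jetOrder x lam t) i * W i β (x t)) / b (x t))) I :=
      ContDiffOn.sum fun j _ => ContDiffOn.sum fun A _ =>
        ((contDiffOn_pi.1 hε A).iteratedDeriv_of_isOpen hI j).smul
          (contDiffOn_comp_jetAt (hHa j A) hI hx hlam hD)
    exact h.congr hη
  have hX : ∀ t ∈ I, G.deltaX x lam ε t = ∑ β, η' t β • S.Z β (x t) := by
    intro t ht
    have hco : ∀ j ∈ Finset.range (G.order + 1), ∀ A, G.R j A (jetAt G.jetOrder x lam t) =
        ∑ β, ((∑ i, G.R j A (jetAt G.jetOrder x lam t) i * W i β (x t)) / b (x t)) •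
          S.Z β (x t) := by
      intro j hj A
      have h := hG.coeffX_eq_sum hba hWa hdual hV hZ hI hx hlam hsol hD1 hb A j t ht
      rwa [coeffX, if_pos (Nat.lt_succ_iff.1 (Finset.mem_range.1 hj))] at h
    simp only [hη' t ht, Finset.sum_smul, mul_smul]
    rw [Finset.sum_comm, deltaX]
    refine Finset.sum_congr rfl fun j hj => ?_
    rw [Finset.sum_comm]
    refine Finset.sum_congr rfl fun A _ => ?_
    rw [← Finset.smul_sum, ← hco j hj A]
  intro t ht
  refine ⟨(hX t ht).trans (deltaX_simpleForm x lam η' t).symm, ?_⟩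
  have h1 := (hG.2.2.2.2 I x lam ε hI hx hlam hε hsol hD1 t ht).1
  have h2 := (isInvariantVariation_characteristic htan hV hZ hsol hb (ε := η')
    (fun t ht β => ((contDiffOn_pi.1 hηs β).differentiableOn (by simp)).differentiableAt
      (hI.mem_nhds ht)) t ht).1
  have hev : (fun t => ∑ β, η' t β • S.Z β (x t)) =ᶠ[𝓝 t] G.deltaX x lam ε := by
    filter_upwards [hI.mem_nhds ht] with s hs
    exact (hX s hs).symm
  -- The terms depending on `δx` agree, which leaves the equality of the combinations of the `Z_α`
  -- with the two values of `δλ`.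
  have h3 := h1.unique (h2.congr_of_eventuallyEq hev.symm)
  simp only [← hX t ht, add_right_inj] at h3
  have hxS := (hsol t ht).1
  funext β
  refine Eq.trans ?_ (deltaLam_simpleForm x lam η' t β).symm
  rw [← dual_apply_sum hdual hxS (hb t ht) (G.deltaLam x lam ε t) β, h3,
    dual_apply_sum hdual hxS (hb t ht)]

end Reduction

end InfTransformation

/-! ### Assembly of the theorem. -/

namespace LocalSystem

variable {n : ℕ} {C : LocalSystem n}

/-- The commutation relations and gauge symmetries of a system whose characteristic fields form a
basis of the gauge distribution. -/
theorem IsComplete.exists_gauge_structure (hcomp : C.IsComplete) (hC : IsConnected C.surface)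
    {r : ℕ} (Zb : Fin r → PhaseSpace n → PhaseSpace n) (hZb : ∀ α, AnalyticOnNhd ℝ (Zb α) C.U)
    (hli : LinearIndependent (OnShellField C.U C.surface)
      (fun α => fieldClass C.U C.surface (Zb α) (hZb α)))
    (hspan : spanFields C.U C.surface Zb = C.gauge) :
    ∃ (b : PhaseSpace n → ℝ) (v : Fin r → Fin r → PhaseSpace n → ℝ)
      (u : Fin r → Fin r → Fin r → PhaseSpace n → ℝ),
      AnalyticOnNhd ℝ b C.U ∧ (∀ α β, AnalyticOnNhd ℝ (v α β) C.U) ∧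
      (∀ α β γ, AnalyticOnNhd ℝ (u α β γ) C.U) ∧
      C.surface ⊆ closure {x | x ∈ C.surface ∧ b x ≠ 0} ∧
      (∀ x ∈ C.surface, b x ≠ 0 → LinearIndependent ℝ (fun α => Zb α x)) ∧
      (∀ x ∈ C.surface, ∀ α,
        b x • VectorField.lieBracket ℝ (Zb α) C.V x = ∑ β, v α β x • Zb β x) ∧
      (∀ x ∈ C.surface, ∀ α β,
        b x • VectorField.lieBracket ℝ (Zb α) (Zb β) x = ∑ γ, u α β γ x • Zb γ x) ∧
      InfTransformation.IsGaugeSymmetry (C.withFields Zb hZb)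
        (InfTransformation.simpleForm C.U Zb b v u) ∧
      ∀ G : InfTransformation n r,
        InfTransformation.IsGaugeSymmetry (C.withFields Zb hZb) G →
        InfTransformation.ReducesTo (C.withFields Zb hZb) b G
          (InfTransformation.simpleForm C.U Zb b v u) := by
  have := isDomain_onShellRing hC
  have hmem : ∀ α, MemDist C.gauge (Zb α) := fun α => ⟨hZb α, by
    rw [← hspan, spanFields_eq_span_range hZb]
    exact Submodule.subset_span ⟨α, rfl⟩⟩
  have htan : ∀ α a, ∀ x ∈ C.surface, alongField (Zb α) (C.T a) x = 0 := fun α =>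
    hcomp.gauge_tangent hC (hmem α)
  have hpres : ∀ α, PreservesTrivial C.U C.surface (Zb α) := fun α =>
    hcomp.preservesTrivial_gauge hC (hmem α)
  have hinv : IsInvolutive C.gauge := isInvolutive_gaugeDistribution C.analytic_V C.analytic_Z
  -- Both kinds of commutators form one finite family, so that a single denominator `b` serves them
  -- and the dual basis. The sign `-1` below turns `[V, Z_α]` into `[Z_α, V]`.
  have hY : ∀ i : Fin r ⊕ Fin r × Fin r, MemDist (spanFields C.U C.surface Zb)
      (Sum.elim (fun α => VectorField.lieBracket ℝ (Zb α) C.V)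
        (fun p : Fin r × Fin r => VectorField.lieBracket ℝ (Zb p.1) (Zb p.2)) i) := by
    rw [hspan]
    rintro (α | p)
    · have h := MemDist.lieBracket_drift C.analytic_V C.analytic_Z C.surface_subset_U
        hcomp.preservesTrivial_V (hmem α)
      refine (h.smul (f := fun _ => -1) analyticOnNhd_const).congr
        ((hZb α).lieBracket C.analytic_V) fun x _ => ?_
      show (-1 : ℝ) • VectorField.lieBracket ℝ C.V (Zb α) x = VectorField.lieBracket ℝ (Zb α) C.V x
      rw [VectorField.lieBracket_swap, neg_one_smul]
      simp
    · exact hinv _ _ (hpres p.1) (hpres p.2) (hmem p.1) (hmem p.2)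
  obtain ⟨b, c, W, hb, hc, hW, hb0, hYc, hdual⟩ := exists_structure_functions hZb hli _ hY
  have hV : ∀ x ∈ C.surface, ∀ α, b x • VectorField.lieBracket ℝ (Zb α) C.V x =
      ∑ β, c (Sum.inl α) β x • Zb β x := fun x hx α => hYc x hx (Sum.inl α)
  have hZ : ∀ x ∈ C.surface, ∀ α β, b x • VectorField.lieBracket ℝ (Zb α) (Zb β) x =
      ∑ γ, c (Sum.inr (α, β)) γ x • Zb γ x := fun x hx α β => hYc x hx (Sum.inr (α, β))
  refine ⟨b, fun α β => c (Sum.inl α) β, fun α β γ => c (Sum.inr (α, β)) γ, hb, fun α β => hc _ _,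
    fun α β γ => hc _ _, C.subset_closure_ne_zero hC.isPreconnected hb hb0, fun x hx hbx => ?_,
    hV, hZ, ?_, fun G hG => ?_⟩
  · exact InfTransformation.linearIndependent_of_dual (S := C.withFields Zb hZb) hdual hx hbx
  · exact InfTransformation.isGaugeSymmetry_simpleForm (S := C.withFields Zb hZb) hb
      (fun α β => hc _ _) (fun α β γ => hc _ _) htan hV hZ
  · exact hG.reducesTo_simpleForm (S := C.withFields Zb hZb) hb hW hdual htan hV hZ

end LocalSystem

end

theorem mainTheorem4 {n : ℕ} (S : LocalSystem n) (hS : S.IsRegular) :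
    (∃ C : LocalSystem n, C.IsCompleteFormOf S) ∧
    ∀ C : LocalSystem n, C.IsCompleteFormOf S →
      -- the gauge distribution is involutive, tangent to the surface and preserved by the drift
      (IsInvolutive C.gauge ∧
        (∀ X, MemDist C.gauge X → ∀ a, ∀ x ∈ C.surface, alongField X (C.T a) x = 0) ∧
        (∀ X, MemDist C.gauge X → MemDist C.gauge (VectorField.lieBracket ℝ C.V X))) ∧
      ∃ (r : ℕ) (Zb : Fin r → PhaseSpace n → PhaseSpace n)
        (hZb : ∀ α, AnalyticOnNhd ℝ (Zb α) C.U),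
        -- the characteristic fields form a basis of the gauge distribution
        (LinearIndependent (OnShellField C.U C.surface)
            (fun α => fieldClass C.U C.surface (Zb α) (hZb α)) ∧
          spanFields C.U C.surface Zb = C.gauge) ∧
        -- no compatibility conditions, same gauge distribution, physical equivalence
        ((C.withFields Zb hZb).IsRegular ∧
          (C.withFields Zb hZb).IsCompleteFormOf (C.withFields Zb hZb) ∧
          gaugeDistribution C.U C.surface C.V Zb = C.gauge ∧
          S.PhysicallyEquivalent (C.withFields Zb hZb)) ∧
        -- same observables with the same evolution law
        (observables (gaugeDistribution C.U C.surface C.V Zb) = observables C.gauge ∧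
          ∀ O, RepresentsObservable C.gauge O →
            RepresentsObservable C.gauge (alongField C.V O) ∧
            (∀ (I : Set ℝ) (x : ℝ → PhaseSpace n) (lam : ℝ → Fin S.l → ℝ), IsOpen I →
              S.IsSolution I x lam → (∀ t ∈ I, x t ∈ C.regularDomain) →
              ∀ t ∈ I, HasDerivAt (fun s => O (x s)) (alongField C.V O (x t)) t) ∧
            (∀ (I : Set ℝ) (x : ℝ → PhaseSpace n) (lam : ℝ → Fin r → ℝ), IsOpen I →
              (C.withFields Zb hZb).IsSolution I x lam →
              ∀ t ∈ I, HasDerivAt (fun s => O (x s)) (alongField C.V O (x t)) t)) ∧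
        -- the gauge transformations take the simple form
        (∃ (b : PhaseSpace n → ℝ) (v : Fin r → Fin r → PhaseSpace n → ℝ)
          (u : Fin r → Fin r → Fin r → PhaseSpace n → ℝ),
          AnalyticOnNhd ℝ b C.U ∧ (∀ α β, AnalyticOnNhd ℝ (v α β) C.U) ∧
          (∀ α β γ, AnalyticOnNhd ℝ (u α β γ) C.U) ∧
          C.surface ⊆ closure {x | x ∈ C.surface ∧ b x ≠ 0} ∧
          (∀ x ∈ C.surface, b x ≠ 0 → LinearIndependent ℝ (fun α => Zb α x)) ∧
          (∀ x ∈ C.surface, ∀ α,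
            b x • VectorField.lieBracket ℝ (Zb α) C.V x = ∑ β, v α β x • Zb β x) ∧
          (∀ x ∈ C.surface, ∀ α β,
            b x • VectorField.lieBracket ℝ (Zb α) (Zb β) x = ∑ γ, u α β γ x • Zb γ x) ∧
          InfTransformation.IsGaugeSymmetry (C.withFields Zb hZb)
            (InfTransformation.simpleForm C.U Zb b v u) ∧
          ∀ G : InfTransformation n r,
            InfTransformation.IsGaugeSymmetry (C.withFields Zb hZb) G →
            InfTransformation.ReducesTo (C.withFields Zb hZb) b G
              (InfTransformation.simpleForm C.U Zb b v u)) := by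
  refine ⟨hS.exists_completeForm, fun C hCS => ?_⟩
  obtain ⟨hreach, hcomp, hconn⟩ := hCS
  have := LocalSystem.isDomain_onShellRing hconn
  have hMU := C.surface_subset_U
  have hVp := hcomp.preservesTrivial_V
  have hinv : IsInvolutive C.gauge := isInvolutive_gaugeDistribution C.analytic_V C.analytic_Z
  have hdrift : ∀ X, MemDist C.gauge X → MemDist C.gauge (VectorField.lieBracket ℝ C.V X) :=
    fun X hX => hX.lieBracket_drift C.analytic_V C.analytic_Z hMU hVp
  refine ⟨⟨hinv, fun X hX => hcomp.gauge_tangent hconn hX, hdrift⟩, ?_⟩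
  obtain ⟨r, Zb, hZb, hli, hspan⟩ := exists_analytic_basis C.gauge
  have hmem : ∀ α, MemDist C.gauge (Zb α) := fun α => ⟨hZb α, by
    rw [← hspan, spanFields_eq_span_range hZb]
    exact Submodule.subset_span ⟨α, rfl⟩⟩
  have hmemZ : ∀ α, MemDist C.gauge (C.Z α) :=
    memDist_gaugeDistribution C.analytic_V C.analytic_Z 0
  -- One inclusion holds because the drift preserves the gauge distribution, the other because the
  -- new fields already span it.
  have hgauge : gaugeDistribution C.U C.surface C.V Zb = C.gauge := by
    refine le_antisymm (gaugeDistribution_le hinv fun j α => ?_) ?_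
    · induction j with
      | zero => exact hmem α
      | succ j ih =>
        rw [Function.iterate_succ_apply']
        exact hdrift _ ih
    · rw [← hspan, spanFields_eq_span_range hZb, Submodule.span_le]
      rintro _ ⟨α, rfl⟩
      exact (memDist_gaugeDistribution (M := C.surface) C.analytic_V hZb 0 α).2
  have hcomp' : (C.withFields Zb hZb).IsComplete :=
    ⟨hcomp.1, hcomp.2.1, fun α => hcomp.gauge_tangent hconn (hmem α)⟩
  have hform : (C.withFields Zb hZb).IsCompleteFormOf (C.withFields Zb hZb) :=
    ⟨Relation.ReflTransGen.refl, hcomp', hconn⟩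
  refine ⟨r, Zb, hZb, ⟨hli, hspan⟩, ⟨hcomp'.isRegular hconn, hform, hgauge, C,
    C.withFields Zb hZb, ⟨hreach, hcomp, hconn⟩, hform, rfl, rfl, fun _ _ => rfl, hgauge.symm⟩,
    ⟨by rw [hgauge], fun O hO => ⟨hcomp.representsObservable_drift hconn hO, ?_, ?_⟩⟩,
    hcomp.exists_gauge_structure hconn Zb hZb hli hspan⟩
  · intro I x lam hI hsol hx t ht
    -- The trajectory also solves the complete form, with the surviving multipliers, and there the
    -- observable is annihilated by all characteristic fields.
    obtain ⟨lam', hsol'⟩ := hreach.exists_isSolution hI hsol hx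
    exact hsol'.hasDerivAt_comp hO.1 (fun α => hcomp.observable_apply hconn hO (hmemZ α)) ht
  · intro I x lam _ hsol t ht
    exact LocalSystem.IsSolution.hasDerivAt_comp (C := C.withFields Zb hZb) hsol hO.1
      (fun α => hcomp.observable_apply hconn hO (hmem α)) ht
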